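/- **Setting.** Let $\mathcal S$ be a set of input locations, $\kappa\ge 1$ the macro-action length, and for every $s\in\mathcal S$ let $\mathcal A(s)\subseteq\mathcal S^\kappa$ be a nonempty finite set of at most $A$ macro-actions. Let $(\sigma_{ss'})$ be a symmetric positive semidefinite covariance function with $\sigma_{ss}\le\sigma_y^2$ (zero-mean Gaussian process prior), and let $\sigma_n^2>0$ be the variance of the independent Gaussian noise of the measurements. Data $d=\langle \mathbf s,\mathbf z\rangle$ consist of a nonempty vector $\mathbf s$ of visited locations and the vector $\mathbf z$ of their measurements; we write $\mathcal A(d)$ for $\mathcal A$ at the last component of $\mathbf s$, and $d\oplus\langle a,z\rangle$ for the data after executing $a$ and observing $z\in\mathbb R^\kappa$. With $\Sigma_{ab}$ the matrix of prior covariances, to which $\sigma_n^2 I$ is added when $a=b$, put $$\mu_{a|d}=\Sigma_{a\mathbf s}\Sigma_{\mathbf s\mathbf s}^{-1}\mathbf z,\qquad \Sigma_{a|\mathbf s}=\Sigma_{aa}-\Sigma_{a\mathbf s}\Sigma_{\mathbf s\mathbf s}^{-1}\Sigma_{\mathbf sa},\qquad R(a,d)=\mathbf 1^\top\mu_{a|d}+\tfrac{\beta}{2}\log\bigl|I+\sigma_n^{-2}\Sigma_{a|\mathbf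 s}\bigr|,$$ with $\beta\in\mathbb R$. Fix a horizon $H\ge1$. All the value functions below are $0$ at stage $H$, and for $t<H$: * for a policy $\pi$ (choosing $\pi_t(d)\in\mathcal A(d)$, measurably in the measurements), $V^\pi_t(d)=R(\pi_t(d),d)+\mathbb E_{z\sim\mathcal N(\mu_{\pi_t(d)|d},\Sigma_{\pi_t(d)|\mathbf s})}\bigl[V^\pi_{t+1}(d\oplus\langle \pi_t(d),z\rangle)\bigr]$; * $V^*_t(d)=\max_{a\in\mathcal A(d)}Q^*_t(a,d)$, $\;Q^*_t(a,d)=R(a,d)+\mathbb E_{z\sim\mathcal N(\mu_{a|d},\Sigma_{a|\mathbf s})}\bigl[V^*_{t+1}(d\oplus\langle a,z\rangle)\bigr]$; * $\mathbb V_t(d)=\max_{a\in\mathcal A(d)}\mathbb Q_t(a,d)$, $\;\mathbb Q_t(a,d)=R(a,d)+\mathbb V_{t+1}(d\oplus\langle a,\mu_{a|d}\rangle)$ (most likely observations); * $\mathcal V_t(d)=\max_{a\in\mathcal A(d)}\mathcal Q_t(a,d)$, $\;\mathcal Q_t(a,d)=R(a,d)+\frac1N\sum_{\ell=1}^N\mathcal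 V_{t+1}(d\oplus\langle a,z^\ell\rangle)$, where $z^1,\dots,z^N$ are i.i.d. from $\mathcal N(\mu_{a|d},\Sigma_{a|\mathbf s})$, drawn independently at all nodes of the planning tree. The policy $\pi^\epsilon$ with parameters $\lambda,\theta,N$ draws at each stage $t$ a fresh independent planning tree rooted at the current data $d$ and executes a maximizer $\pi^\epsilon_t(d)\in\operatorname{argmax}_{a\in\mathcal A(d)}Q^\epsilon_t(a,d)$ (ties are broken by a fixed rule), where $Q^\epsilon_t(a,d)=\mathcal Q_t(a,d)$ if $|\mathcal Q_t(a,d)-\mathbb Q_t(a,d)|\le\lambda H+\theta$ and $Q^\epsilon_t(a,d)=\mathbb Q_t(a,d)$ otherwise. **Theorem.** There is a constant $c_0>0$ depending only on $H,\sigma_y^2,\sigma_n^2$ and, for every $c\ge c_0$, a constant $C>0$ depending only on $c,H,\sigma_y^2,\sigma_n^2$, such that for every problem as above, with $\theta=c\,\kappa^{H+1/2}$: 1. $|\mathbb Q_t(a,d)-Q^*_t(a,d)|\le\theta$ for all $t<H$, all data $d$ and all $a\in\mathcal A(d)$; and $V^*_0(d_0)=\max_\pi V^\pi_0(d_0)$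 for all $d_0$. 2. For every $\epsilon>0$, with $\delta=\epsilon/(8\theta H)$ and $\lambda=\epsilon/(4H^2)$, and for every number of samples $$N\ \ge\ C\,\frac{\kappa^{2H}}{\epsilon^2}\,\log\Bigl(2+\frac{\kappa A}{\epsilon}\Bigr)$$ (so that $N=\mathcal O\bigl((\kappa^{2H}/\epsilon^2)\log(\kappa A/\epsilon)\bigr)$ samples suffice as $\epsilon\to0$): for all $t<H$ and all data $d$, with probability at least $1-\delta$, $|\mathcal Q_t(a,d)-Q^*_t(a,d)|\le\lambda H$ for all $a\in\mathcal A(d)$; and the policy $\pi^\epsilon$ satisfies, for all $d_0$, $$V^*_0(d_0)-\mathbb E_{\pi^\epsilon}\bigl[V^{\pi^\epsilon}_0(d_0)\bigr]\le\epsilon .$$ -/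

import Mathlib

open MeasureTheory ProbabilityTheory

universe u

noncomputable section

/-- A macro-action of length `κ`: a sequence of `κ` input locations. -/
abbrev MacroAction (S : Type u) (κ : ℕ) : Type u := Fin κ → S

/-- The observations (data) gathered so far: a nonempty vector of visited input locations and the
vector of the corresponding noisy output measurements. -/
structure History (S : Type u) where
  /-- number of observations -/
  len : ℕ
  len_pos : 0 < len
  /-- visited input locations, in order -/
  loc : Fin len → S
  /-- observed output measurements, in order -/
  out : Fin len → ℝ

namespace History

variable {S : Type u} {κ : ℕ}

/-- The current input location: the last visited one. -/
def current (d : History S) : S := d.loc ⟨d.len - 1, Nat.sub_lt d.len_pos Nat.one_pos⟩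

/-- Append a macro-action and the output measurements observed along it. -/
def extend (d : History S) (a : MacroAction S κ) (z : EuclideanSpace ℝ (Fin κ)) : History S where
  len := d.len + κ
  len_pos := Nat.add_pos_left d.len_pos κ
  loc := Fin.append d.loc a
  out := Fin.append d.out fun i => z i

end History

/-- A macro-action Gaussian process optimization problem on a set `S` of input locations with
macro-actions of length `κ`: a zero-mean Gaussian process prior with covariance function `cov`,
additive independent Gaussian observation noise of variance `noiseVar`, a nonempty finite set of
available macro-actions at every input location, and a weight of the exploration term. -/
structure MacroGPO (S : Type u) (κ : ℕ) where
  /-- the prior covariance function -/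
  cov : Matrix S S ℝ
  /-- every finite Gram matrix of `cov` is symmetric positive semidefinite -/
  cov_posSemidef : cov.PosSemidef
  /-- the noise variance -/
  noiseVar : ℝ
  noiseVar_pos : 0 < noiseVar
  /-- the weight of the exploration term -/
  weight : ℝ
  /-- the macro-actions available at an input location -/
  actions : S → Finset (MacroAction S κ)
  actions_nonempty : ∀ s, (actions s).Nonempty

namespace MacroGPO

variable {S : Type u} {κ : ℕ} (P : MacroGPO S κ)

/-! ### Gaussian process posterior -/

/-- Prior covariance between the outputs at two vectors of input locations. -/
def crossCov {m n : ℕ} (a : Fin m → S) (b : Fin n → S) : Matrix (Fin m) (Fin n) ℝ :=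
  Matrix.of fun i j => P.cov (a i) (b j)

/-- Prior covariance matrix of the noisy measurements at a vector of input locations; the noise
is independent between measurements. -/
def noisyCov {n : ℕ} (s : Fin n → S) : Matrix (Fin n) (Fin n) ℝ :=
  P.crossCov s s + P.noiseVar • (1 : Matrix (Fin n) (Fin n) ℝ)

/-- Posterior mean vector of the measurements along `a` given the data `d`. -/
def postMean (d : History S) (a : MacroAction S κ) : EuclideanSpace ℝ (Fin κ) :=
  WithLp.toLp 2 ((P.crossCov a d.loc * (P.noisyCov d.loc)⁻¹).mulVec d.out)

/-- Posterior covariance matrix of the measurements along `a` given the data `d`. -/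
def postCov (d : History S) (a : MacroAction S κ) : Matrix (Fin κ) (Fin κ) ℝ :=
  P.noisyCov a - P.crossCov a d.loc * (P.noisyCov d.loc)⁻¹ * P.crossCov d.loc a

/-- The Gaussian posterior belief of the measurements along `a` given the data `d`. -/
def belief (d : History S) (a : MacroAction S κ) : Measure (EuclideanSpace ℝ (Fin κ)) :=
  multivariateGaussian (P.postMean d a) (P.postCov d a)

/-- The stage reward: the expected sum of the measurements along `a`, plus the weighted
exploration term. -/
def reward (d : History S) (a : MacroAction S κ) : ℝ :=
  ∑ i, P.postMean d a i
    + (1 / 2) * P.weight * Real.log (1 + P.noiseVar⁻¹ • P.postCov d a).det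

/-! ### Values of policies and optimal values

In all the recursions below, the natural number that is recursed on is the number of remaining
stages, so that at stage `t` of horizon `H` the value function is taken at `H - t`, and the
`Q`-function, which counts the stages after the current one, at `H - (t + 1)`. -/

/-- A deterministic adaptive policy assigns a macro-action to a stage and the current data. It is
admissible if it chooses available macro-actions only and depends measurably on the measurements. -/
structure IsPolicy (π : ℕ → History S → MacroAction S κ) : Prop where
  mem_actions : ∀ t d, π t d ∈ P.actions d.current
  measurable : ∀ (t n : ℕ) (hn : 0 < n) (s : Fin n → S) (a : MacroAction S κ),
    MeasurableSet {z : Fin n → ℝ | π t ⟨n, hn, s, z⟩ = a}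

/-- The value of following the policy `π` from stage `t` on, starting from the data `d`, when the
given number of stages remains. -/
def policyValue (π : ℕ → History S → MacroAction S κ) : ℕ → ℕ → History S → ℝ
  | 0, _, _ => 0
  | r + 1, t, d =>
      P.reward d (π t d)
        + ∫ z, policyValue π r (t + 1) (d.extend (π t d) z) ∂(P.belief d (π t d))

/-- The Bayes-optimal value `V*`. -/
def optV : ℕ → History S → ℝ
  | 0, _ => 0
  | r + 1, d =>
      (P.actions d.current).sup' (P.actions_nonempty _) fun a =>
        P.reward d a + ∫ z, optV r (d.extend a z) ∂(P.belief d a)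

/-- The Bayes-optimal `Q`-function `Q*`. -/
def optQ (r : ℕ) (d : History S) (a : MacroAction S κ) : ℝ :=
  P.reward d a + ∫ z, P.optV r (d.extend a z) ∂(P.belief d a)

/-! ### Most likely observations -/

/-- The value obtained by replacing future measurements by their posterior mean. -/
def mlV : ℕ → History S → ℝ
  | 0, _ => 0
  | r + 1, d =>
      (P.actions d.current).sup' (P.actions_nonempty _) fun a =>
        P.reward d a + mlV r (d.extend a (P.postMean d a))

/-- The `Q`-function of the most likely observations. -/
def mlQ (r : ℕ) (d : History S) (a : MacroAction S κ) : ℝ :=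
  P.reward d a + P.mlV r (d.extend a (P.postMean d a))

/-! ### Stochastic sampling -/

/-- The randomness of one planning tree: a vector for every node, where a node is the list of the
macro-actions and of the sample indices on the path that leads to it from the root. -/
abbrev Seed (S : Type u) (κ N : ℕ) : Type u :=
  List (MacroAction S κ × Fin N) → EuclideanSpace ℝ (Fin κ)

/-- Independent standard Gaussian vectors at all nodes. -/
def seedMeasure (S : Type u) (κ N : ℕ) : Measure (Seed S κ N) :=
  Measure.infinitePi fun _ => stdGaussian (EuclideanSpace ℝ (Fin κ))

/-- The randomness of a run: independent planning trees for all stages. -/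
def runMeasure (S : Type u) (κ N : ℕ) : Measure (ℕ → Seed S κ N) :=
  Measure.infinitePi fun _ => seedMeasure S κ N

open scoped MatrixOrder in
/-- Transform a standard Gaussian vector into a sample from the posterior belief `P.belief d a`. -/
def sample (d : History S) (a : MacroAction S κ) (x : EuclideanSpace ℝ (Fin κ)) :
    EuclideanSpace ℝ (Fin κ) :=
  P.postMean d a + Matrix.toEuclideanCLM (𝕜 := ℝ) (CFC.sqrt (P.postCov d a)) x

/-- If `x` is standard Gaussian, then `P.sample d a x` has the law `P.belief d a`. -/
theorem map_sample (d : History S) (a : MacroAction S κ) :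
    (stdGaussian (EuclideanSpace ℝ (Fin κ))).map (P.sample d a) = P.belief d a := rfl

/-- The value computed from the planning tree with randomness `ω` rooted at `d`, with `N` samples
for every macro-action at every node. -/
def sampV {N : ℕ} : ℕ → History S → Seed S κ N → ℝ
  | 0, _, _ => 0
  | r + 1, d, ω =>
      (P.actions d.current).sup' (P.actions_nonempty _) fun a =>
        P.reward d a + (1 / (N : ℝ)) * ∑ l : Fin N,
          sampV r (d.extend a (P.sample d a (ω [(a, l)]))) fun p => ω ((a, l) :: p)

/-- The `Q`-function computed from the planning tree with randomness `ω` rooted at `d`. -/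
def sampQ {N : ℕ} (r : ℕ) (d : History S) (a : MacroAction S κ) (ω : Seed S κ N) : ℝ :=
  P.reward d a + (1 / (N : ℝ)) * ∑ l : Fin N,
    P.sampV r (d.extend a (P.sample d a (ω [(a, l)]))) fun p => ω ((a, l) :: p)

/-! ### The `ε`-Macro-GPO policy -/

open Classical in
/-- The sampled `Q`-value if it differs from the `Q`-value of the most likely observations by at
most `tol`, and the latter otherwise. -/
def epsQ {N : ℕ} (tol : ℝ) (r : ℕ) (d : History S) (a : MacroAction S κ) (ω : Seed S κ N) : ℝ :=
  if |P.sampQ r d a ω - P.mlQ r d a| ≤ tol then P.sampQ r d a ω else P.mlQ r d a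

open Classical in
/-- The available macro-actions that maximize `epsQ`. -/
def epsArgmax {N : ℕ} (tol : ℝ) (r : ℕ) (d : History S) (ω : Seed S κ N) :
    Finset (MacroAction S κ) :=
  (P.actions d.current).filter fun a =>
    ∀ b ∈ P.actions d.current, P.epsQ tol r d b ω ≤ P.epsQ tol r d a ω

/-- The `ε`-Macro-GPO policy of horizon `H` for given run randomness `ω`; `tie` selects one of
the maximizers. -/
def epsPolicy (H : ℕ) {N : ℕ} (lam theta : ℝ) (tie : Finset (MacroAction S κ) → MacroAction S κ)
    (ω : ℕ → Seed S κ N) (t : ℕ) (d : History S) : MacroAction S κ :=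
  tie (P.epsArgmax (lam * H + theta) (H - (t + 1)) d (ω t))

end MacroGPO

end

noncomputable section

/-! The posterior covariance does not involve the measurements, and the posterior mean is linear in
them, with gain rows of Euclidean norm at most `√(Y / noiseVar)` whatever the number of data
(`sum_sq_gain_le`). If two beliefs at the same locations are driven by the same standard Gaussian
vector, their samples differ only by the difference of the means. Backward induction then makes
`optV` with `r` remaining stages Lipschitz in the measurements with constant of order `κ ^ r`
(`lipschitzInOut_optV`). Replacing an observation by its mean costs this constant times the expected
distance to the mean, which is of order `κ`. Summed over the stages this is of order `κ ^ H`, hence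
below `theta`.

For the sampled tree, a union bound over nodes would bring powers of `N` into the failure
probability. Instead, exponential moments of the error are propagated
(`lintegral_exp_abs_sampV_sub_optV_le`). At one level the error of `sampQ` is at most the average of
the subtree errors plus the fluctuation of an average of `N` values of `optV`. Averaging does not
increase the bound on the exponential moment; the fluctuation contributes a factor `exp (s ^ 2 * K /
N)` with `K` of order `κ ^ (2 * H - 1)` (`lintegral_exp_lipschitz_sub_integral_le`); the absolute
value costs a factor 2 and the maximum a factor `A`. The number of nodes never enters. Markov's
inequality gives failure probability at most `(2 * A) ^ H * exp (-(N * b ^ 2 / (4 * H * K)))`, and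
`exists_sample_size_const` converts this into a sample size.

For the policy, `epsQ` is always within `lam * H + 2 * theta` of `optQ`, and within `lam * H` if all
sampled values are accurate. The expected loss of a decision is thus at most `2 * lam * H + 4 *
theta * delta`. Because each stage uses a fresh seed, these losses add up over the `H` stages
(`IsRandomPolicy.optV_sub_integral_policyValue_le`), to `eps / 2 + eps / 2`. -/

/-! ### Elementary inequalities and product measures. -/

theorem Finset.abs_sup'_sub_sup'_le {ι : Type*} {s : Finset ι} (hs : s.Nonempty) {f g : ι → ℝ}
    {c : ℝ} (h : ∀ i ∈ s, |f i - g i| ≤ c) : |s.sup' hs f - s.sup' hs g| ≤ c := by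
  rw [abs_le]
  constructor
  · have : s.sup' hs g ≤ s.sup' hs f + c := Finset.sup'_le hs _ fun i hi => by
      have h1 := Finset.le_sup' f hi
      have h2 := (abs_le.1 (h i hi)).1
      linarith
    linarith
  · have : s.sup' hs f ≤ s.sup' hs g + c := Finset.sup'_le hs _ fun i hi => by
      have h1 := Finset.le_sup' g hi
      have h2 := (abs_le.1 (h i hi)).2
      linarith
    linarith

/-- Compare power series: only even powers occur, and by convexity of `u ↦ u ^ n` the power `(‖x‖ ^
2) ^ n` is at most the mean of the `(κ * x i ^ 2) ^ n`. This reduces a norm inside an exponential to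
single coordinates. -/
theorem cosh_mul_norm_le {κ : ℕ} (hκ : 0 < κ) (t : ℝ) (x : EuclideanSpace ℝ (Fin κ)) :
    Real.cosh (t * ‖x‖) ≤ ∑ i, (1 / (κ : ℝ)) * Real.cosh (t * √κ * x i) := by
  have hκ' : (0 : ℝ) < κ := by exact_mod_cast hκ
  have h1 := Real.hasSum_cosh (t * ‖x‖)
  have h2 : HasSum (fun n => ∑ i, (1 / (κ : ℝ)) * ((t * √κ * x i) ^ (2 * n) / ((2 * n).factorial : ℝ)))
      (∑ i, (1 / (κ : ℝ)) * Real.cosh (t * √κ * x i)) :=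
    hasSum_sum fun i _ => (Real.hasSum_cosh _).mul_left _
  refine hasSum_le (fun n => ?_) h1 h2
  have key : (∑ i, x i ^ 2) ^ n ≤ ∑ i, (1 / (κ : ℝ)) * ((κ : ℝ) * x i ^ 2) ^ n := by
    have := Real.pow_arith_mean_le_arith_mean_pow Finset.univ (fun _ : Fin κ => 1 / (κ : ℝ))
      (fun i => (κ : ℝ) * x i ^ 2) (fun _ _ => by positivity) (by simp [hκ'.ne'])
      (fun _ _ => by positivity) n
    refine le_trans (le_of_eq ?_) this
    congr 1
    refine Finset.sum_congr rfl fun i _ => ?_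
    field_simp
  have e1 : (t * ‖x‖) ^ (2 * n) = t ^ (2 * n) * (∑ i, x i ^ 2) ^ n := by
    rw [mul_pow, pow_mul ‖x‖, EuclideanSpace.real_norm_sq_eq]
  have e2 : ∀ i, (t * √κ * x i) ^ (2 * n) = t ^ (2 * n) * ((κ : ℝ) * x i ^ 2) ^ n := by
    intro i
    rw [mul_assoc, mul_pow, pow_mul (√κ * x i), mul_pow (√κ), Real.sq_sqrt hκ'.le]
  simp only [e1, e2]
  have : ∑ i, 1 / (κ : ℝ) * (t ^ (2 * n) * ((κ : ℝ) * x i ^ 2) ^ n / ((2 * n).factorial : ℝ))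
      = t ^ (2 * n) * (∑ i, (1 / (κ : ℝ)) * ((κ : ℝ) * x i ^ 2) ^ n) / ((2 * n).factorial : ℝ) := by
    rw [Finset.mul_sum, Finset.sum_div]
    exact Finset.sum_congr rfl fun i _ => by ring
  rw [this]
  have ht : 0 ≤ t ^ (2 * n) := by rw [pow_mul]; positivity
  gcongr

/-- Jensen's inequality from the tangent of `exp` at the mean. The extended integral makes the case
of a non-integrable exponential trivial. -/
theorem ofReal_exp_integral_le_lintegral {Ω : Type*} [MeasurableSpace Ω] {μ : Measure Ω}
    [IsProbabilityMeasure μ] {g : Ω → ℝ} (hg : Integrable g μ) :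
    ENNReal.ofReal (Real.exp (∫ x, g x ∂μ)) ≤ ∫⁻ x, ENNReal.ofReal (Real.exp (g x)) ∂μ := by
  set m := ∫ x, g x ∂μ
  by_cases h : Integrable (fun x => Real.exp (g x)) μ
  · rw [← ofReal_integral_eq_lintegral_ofReal h (ae_of_all _ fun x => (Real.exp_pos _).le)]
    apply ENNReal.ofReal_le_ofReal
    have hi : Integrable (fun x => Real.exp m * (g x - m + 1)) μ :=
      ((hg.sub (integrable_const _)).add (integrable_const _)).const_mul _
    calc Real.exp m = ∫ x, Real.exp m * (g x - m + 1) ∂μ := by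
          have hgm : Integrable (fun x => g x - m) μ := hg.sub (integrable_const _)
          rw [integral_const_mul, integral_add hgm (integrable_const _),
            integral_sub hg (integrable_const _)]
          simp [m]
      _ ≤ ∫ x, Real.exp (g x) ∂μ := by
          refine integral_mono hi h fun x => ?_
          have h1 := Real.add_one_le_exp (g x - m)
          have h2 : Real.exp (g x) = Real.exp m * Real.exp (g x - m) := by
            rw [← Real.exp_add]; congr 1; ring
          simp only [h2]
          gcongr
  · have : ∫⁻ x, ENNReal.ofReal (Real.exp (g x)) ∂μ = ⊤ := by
      by_contra hne
      apply h
      refine ⟨Real.continuous_exp.comp_aestronglyMeasurable hg.1, ?_⟩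
      rw [hasFiniteIntegral_iff_ofReal (ae_of_all _ fun x => (Real.exp_pos _).le)]
      exact lt_top_iff_ne_top.2 hne
    rw [this]
    exact le_top

/-- Hölder's inequality against the constant 1; exponents 0 and 1 are separate because they have no
conjugate exponent greater than 1. -/
theorem lintegral_pow_le_lintegral_pow {Ω : Type*} [MeasurableSpace Ω] {μ : Measure Ω}
    [IsProbabilityMeasure μ] {f : Ω → ENNReal} (hf : AEMeasurable f μ) (n : ℕ) :
    (∫⁻ x, f x ∂μ) ^ n ≤ ∫⁻ x, f x ^ n ∂μ := by
  rcases Nat.eq_zero_or_pos n with rfl | hn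
  · simp
  have hn' : (1 : ℝ) ≤ n := by exact_mod_cast hn
  rcases eq_or_lt_of_le hn' with h1 | h1
  · have : n = 1 := by exact_mod_cast h1.symm
    subst this; simp
  have hpq := Real.HolderConjugate.conjExponent h1
  have := ENNReal.lintegral_mul_le_Lp_mul_Lq μ hpq hf (aemeasurable_const (b := (1 : ENNReal)))
  simp only [Pi.mul_apply, mul_one, ENNReal.one_rpow, lintegral_const, measure_univ,
    ENNReal.rpow_natCast] at this
  calc (∫⁻ x, f x ∂μ) ^ n ≤ ((∫⁻ x, f x ^ n ∂μ) ^ (1 / (n : ℝ))) ^ n := by gcongr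
    _ = ∫⁻ x, f x ^ n ∂μ := by
      rw [← ENNReal.rpow_natCast, ← ENNReal.rpow_mul, one_div_mul_cancel (by positivity),
        ENNReal.rpow_one]

/-- Resampling one coordinate preserves an i.i.d. product. This separates the root vector of a seed,
and the seed of one stage of a run, from the remaining randomness. -/
theorem MeasureTheory.Measure.map_update_infinitePi {ι X : Type*} [DecidableEq ι] [MeasurableSpace X]
    (ν : Measure X) [IsProbabilityMeasure ν] (i : ι) :
    (((Measure.infinitePi fun _ : ι => ν).prod ν).map fun p => Function.update p.1 i p.2)
      = Measure.infinitePi fun _ : ι => ν := by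
  refine Measure.eq_infinitePi _ fun s t ht => ?_
  have hm : Measurable fun p : (ι → X) × X => Function.update p.1 i p.2 := by
    refine measurable_pi_lambda _ fun j => ?_
    by_cases hj : j = i
    · subst hj; simpa using measurable_snd
    · simp only [Function.update_of_ne hj]
      exact (measurable_pi_apply j).comp measurable_fst
  rw [Measure.map_apply hm (MeasurableSet.pi s.countable_toSet fun j _ => ht j)]
  by_cases hi : i ∈ s
  · have : (fun p : (ι → X) × X => Function.update p.1 i p.2) ⁻¹' (Set.pi s t)
        = (Set.pi ((s.erase i : Finset ι) : Set ι) t) ×ˢ t i := by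
      ext p
      simp only [Set.mem_preimage, Set.mem_pi, Finset.mem_coe, Set.mem_prod, Finset.mem_erase]
      constructor
      · intro h
        refine ⟨fun j hj => ?_, by simpa using h i hi⟩
        simpa [Function.update_of_ne hj.1] using h j hj.2
      · rintro ⟨h1, h2⟩ j hj
        by_cases hji : j = i
        · subst hji; simpa using h2
        · simpa [Function.update_of_ne hji] using h1 j ⟨hji, hj⟩
    rw [this, Measure.prod_prod, Measure.infinitePi_pi _ fun j _ => ht j,
      Finset.prod_erase_mul _ _ hi]
  · have : (fun p : (ι → X) × X => Function.update p.1 i p.2) ⁻¹' (Set.pi s t)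
        = (Set.pi (s : Set ι) t) ×ˢ Set.univ := by
      ext p
      simp only [Set.mem_preimage, Set.mem_pi, Finset.mem_coe, Set.mem_prod, Set.mem_univ, and_true]
      refine forall₂_congr fun j hj => ?_
      rw [Function.update_of_ne (by rintro rfl; exact hi hj)]
    rw [this, Measure.prod_prod, Measure.infinitePi_pi _ fun j _ => ht j, measure_univ, mul_one]

theorem measurable_update_prod {ι X : Type*} [DecidableEq ι] [MeasurableSpace X] (i : ι) :
    Measurable fun p : (ι → X) × X => Function.update p.1 i p.2 := by
  refine measurable_pi_lambda _ fun j => ?_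
  by_cases hj : j = i
  · subst hj; simpa using measurable_snd
  · simp only [Function.update_of_ne hj]
    exact (measurable_pi_apply j).comp measurable_fst

/-! ### Moments of Lipschitz functions of Gaussian vectors. -/

section Gaussian

variable {κ : ℕ} {m : EuclideanSpace ℝ (Fin κ)} {S : Matrix (Fin κ) (Fin κ) ℝ}

theorem lintegral_exp_mul_eval_multivariateGaussian (hS : S.PosSemidef) (i : Fin κ) (t : ℝ) :
    ∫⁻ z, ENNReal.ofReal (Real.exp (t * z i)) ∂(multivariateGaussian m S)
      = ENNReal.ofReal (Real.exp (m i * t + S i i * t ^ 2 / 2)) := by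
  have hmp := measurePreserving_eval_multivariateGaussian (μ := m) hS (i := i)
  rw [hmp.lintegral_comp (f := fun y => ENNReal.ofReal (Real.exp (t * y))) (by fun_prop),
    ← ofReal_integral_eq_lintegral_ofReal (integrable_exp_mul_gaussianReal t)
      (ae_of_all _ fun x => (Real.exp_pos _).le)]
  have := congrFun (mgf_fun_id_gaussianReal (μ := m i) (v := (S i i).toNNReal)) t
  rw [mgf] at this
  rw [this, Real.coe_toNNReal _ hS.diag_nonneg]

/-- Symmetrization: Jensen's inequality replaces the mean by an independent copy `z'`. Exchanging
`z` and `z'` turns `exp` into `cosh`, which is even and hence controlled by the Lipschitz bound;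
`cosh_mul_norm_le` then leaves the coordinates `z i - z' i`, Gaussian of variance `2 * S i i`. The
factor `κ` in the exponent is the price for ignoring correlations. -/
theorem lintegral_exp_lipschitz_sub_integral_le (hκ : 0 < κ) (hS : S.PosSemidef) {v : ℝ}
    (hv : ∀ i, S i i ≤ v) {f : EuclideanSpace ℝ (Fin κ) → ℝ} {L : ℝ}
    (hfm : Measurable f) (hf : ∀ z z', |f z - f z'| ≤ L * ‖z - z'‖)
    (hfi : Integrable f (multivariateGaussian m S)) (τ : ℝ) :
    ∫⁻ z, ENNReal.ofReal (Real.exp (τ * (f z - ∫ y, f y ∂(multivariateGaussian m S))))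
        ∂(multivariateGaussian m S)
      ≤ ENNReal.ofReal (Real.exp (τ ^ 2 * L ^ 2 * κ * v)) := by
  set ν := multivariateGaussian m S with hν
  set t : ℝ := τ * L * √κ with ht
  have hκ' : (0 : ℝ) < κ := by exact_mod_cast hκ
  set A := ∫⁻ z, ∫⁻ z', ENNReal.ofReal (Real.exp (τ * (f z - f z'))) ∂ν ∂ν with hA
  have h1 : ∫⁻ z, ENNReal.ofReal (Real.exp (τ * (f z - ∫ y, f y ∂ν))) ∂ν ≤ A := by
    refine lintegral_mono fun z => ?_
    have hi : Integrable (fun z' => τ * (f z - f z')) ν :=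
      ((integrable_const _).sub hfi).const_mul _
    have e : τ * (f z - ∫ y, f y ∂ν) = ∫ z', τ * (f z - f z') ∂ν := by
      rw [integral_const_mul, integral_sub (integrable_const _) hfi]; simp
    rw [e]
    exact ofReal_exp_integral_le_lintegral hi
  have hswap : A = ∫⁻ z, ∫⁻ z', ENNReal.ofReal (Real.exp (τ * (f z' - f z))) ∂ν ∂ν := by
    rw [hA, lintegral_lintegral_swap]
    have : Measurable fun p : EuclideanSpace ℝ (Fin κ) × EuclideanSpace ℝ (Fin κ) =>
        ENNReal.ofReal (Real.exp (τ * (f p.1 - f p.2))) := by fun_prop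
    exact this.aemeasurable
  have hcoord : ∀ (i : Fin κ) (t : ℝ), ∫⁻ z, ∫⁻ z', ENNReal.ofReal (Real.exp (t * (z i - z' i))) ∂ν ∂ν
      = ENNReal.ofReal (Real.exp (S i i * t ^ 2)) := by
    intro i t
    have e : ∀ z z' : EuclideanSpace ℝ (Fin κ), ENNReal.ofReal (Real.exp (t * (z i - z' i)))
        = ENNReal.ofReal (Real.exp (t * z i)) * ENNReal.ofReal (Real.exp ((-t) * z' i)) := by
      intro z z'
      rw [← ENNReal.ofReal_mul (Real.exp_pos _).le, ← Real.exp_add]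
      congr 2; ring
    simp_rw [e]
    have : ∀ z : EuclideanSpace ℝ (Fin κ), ∫⁻ z', ENNReal.ofReal (Real.exp (t * z i))
          * ENNReal.ofReal (Real.exp ((-t) * z' i)) ∂ν
        = ENNReal.ofReal (Real.exp (t * z i))
          * ENNReal.ofReal (Real.exp (m i * (-t) + S i i * (-t) ^ 2 / 2)) := by
      intro z
      rw [lintegral_const_mul _ (by fun_prop), lintegral_exp_mul_eval_multivariateGaussian hS]
    simp_rw [this]
    rw [lintegral_mul_const _ (by fun_prop), lintegral_exp_mul_eval_multivariateGaussian hS,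
      ← ENNReal.ofReal_mul (Real.exp_pos _).le, ← Real.exp_add]
    congr 2; ring
  -- The two copies of `A` carry opposite signs of `f z - f z'`, so their integrands sum to twice a
  -- `cosh`.
  have h2 : A + A ≤ ∑ i : Fin κ, ENNReal.ofReal (1 / (κ : ℝ)) *
      (ENNReal.ofReal (Real.exp (S i i * t ^ 2)) + ENNReal.ofReal (Real.exp (S i i * (-t) ^ 2))) := by
    calc A + A = ∫⁻ z, ∫⁻ z', ENNReal.ofReal (Real.exp (τ * (f z - f z'))) ∂ν ∂ν
          + ∫⁻ z, ∫⁻ z', ENNReal.ofReal (Real.exp (τ * (f z' - f z))) ∂ν ∂ν := by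
          rw [← hswap]
      _ = ∫⁻ z, ∫⁻ z', (ENNReal.ofReal (Real.exp (τ * (f z - f z')))
            + ENNReal.ofReal (Real.exp (τ * (f z' - f z)))) ∂ν ∂ν := by
          rw [← lintegral_add_left]
          · refine lintegral_congr fun z => ?_
            rw [lintegral_add_left (by fun_prop)]
          · refine Measurable.lintegral_prod_right' (f := fun p : _ × _ =>
              ENNReal.ofReal (Real.exp (τ * (f p.1 - f p.2)))) (by fun_prop)
      _ ≤ ∫⁻ z, ∫⁻ z', ∑ i : Fin κ, ENNReal.ofReal (1 / (κ : ℝ)) *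
            (ENNReal.ofReal (Real.exp (t * (z i - z' i)))
              + ENNReal.ofReal (Real.exp ((-t) * (z i - z' i)))) ∂ν ∂ν := by
          refine lintegral_mono fun z => lintegral_mono fun z' => ?_
          simp only
          have e : ∀ i : Fin κ, ENNReal.ofReal (1 / (κ : ℝ)) *
            (ENNReal.ofReal (Real.exp (t * (z i - z' i)))
              + ENNReal.ofReal (Real.exp ((-t) * (z i - z' i))))
              = ENNReal.ofReal (1 / (κ : ℝ) * (2 * Real.cosh (t * (z i - z' i)))) := by
            intro i
            rw [← ENNReal.ofReal_add (Real.exp_pos _).le (Real.exp_pos _).le,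
              ← ENNReal.ofReal_mul (by positivity), Real.cosh_eq]
            congr 2
            rw [neg_mul]; ring
          simp_rw [e]
          rw [← ENNReal.ofReal_sum_of_nonneg fun i _ => by
              have := Real.cosh_pos (t * (z i - z' i)); positivity,
            ← ENNReal.ofReal_add (Real.exp_pos _).le (Real.exp_pos _).le]
          apply ENNReal.ofReal_le_ofReal
          have c1 : Real.exp (τ * (f z - f z')) + Real.exp (τ * (f z' - f z))
              = 2 * Real.cosh (τ * (f z - f z')) := by
            rw [Real.cosh_eq, show -(τ * (f z - f z')) = τ * (f z' - f z) by ring]; ring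
          have c2 : Real.cosh (τ * (f z - f z')) ≤ Real.cosh (τ * L * ‖z - z'‖) := by
            rw [Real.cosh_le_cosh, abs_mul, mul_assoc, abs_mul τ]
            exact mul_le_mul_of_nonneg_left ((hf z z').trans (le_abs_self _)) (abs_nonneg _)
          have c3 := cosh_mul_norm_le hκ (τ * L) (z - z')
          rw [c1]
          calc 2 * Real.cosh (τ * (f z - f z')) ≤ 2 * ∑ i, (1 / (κ : ℝ)) *
                Real.cosh (τ * L * √κ * (z - z') i) := by linarith
            _ = _ := by
              rw [Finset.mul_sum]
              refine Finset.sum_congr rfl fun i _ => ?_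
              simp only [ht, PiLp.sub_apply]; ring
      _ = _ := by
          have hm : ∀ (i : Fin κ) (t : ℝ),
              Measurable fun p : EuclideanSpace ℝ (Fin κ) × EuclideanSpace ℝ (Fin κ) =>
              ENNReal.ofReal (Real.exp (t * (p.1 i - p.2 i))) := by
            intro i t; fun_prop
          have hm1 : ∀ (i : Fin κ) (t : ℝ) (z : EuclideanSpace ℝ (Fin κ)),
              Measurable fun z' : EuclideanSpace ℝ (Fin κ) =>
              ENNReal.ofReal (Real.exp (t * (z i - z' i))) := by
            intro i t z; fun_prop
          have hm2 : ∀ (i : Fin κ) (t : ℝ),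
              Measurable fun z : EuclideanSpace ℝ (Fin κ) =>
              ∫⁻ z', ENNReal.ofReal (Real.exp (t * (z i - z' i))) ∂ν :=
            fun i t => (hm i t).lintegral_prod_right'
          have hm3 : ∀ (i : Fin κ) (z : EuclideanSpace ℝ (Fin κ)),
              Measurable fun z' : EuclideanSpace ℝ (Fin κ) =>
              ENNReal.ofReal (Real.exp (t * (z i - z' i)))
                + ENNReal.ofReal (Real.exp ((-t) * (z i - z' i))) :=
            fun i z => (hm1 i t z).add (hm1 i (-t) z)
          have hm4 : ∀ i : Fin κ, Measurable fun z : EuclideanSpace ℝ (Fin κ) =>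
              ∫⁻ z', ENNReal.ofReal (Real.exp (t * (z i - z' i))) ∂ν
                + ∫⁻ z', ENNReal.ofReal (Real.exp ((-t) * (z i - z' i))) ∂ν :=
            fun i => (hm2 i t).add (hm2 i (-t))
          have e1 : ∀ z : EuclideanSpace ℝ (Fin κ), ∫⁻ z', ∑ i : Fin κ, ENNReal.ofReal (1 / (κ : ℝ)) *
            (ENNReal.ofReal (Real.exp (t * (z i - z' i)))
              + ENNReal.ofReal (Real.exp ((-t) * (z i - z' i)))) ∂ν
              = ∑ i : Fin κ, ENNReal.ofReal (1 / (κ : ℝ)) *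
                (∫⁻ z', ENNReal.ofReal (Real.exp (t * (z i - z' i))) ∂ν
                + ∫⁻ z', ENNReal.ofReal (Real.exp ((-t) * (z i - z' i))) ∂ν) := by
            intro z
            rw [lintegral_finsetSum _ fun i _ => (hm3 i z).const_mul _]
            refine Finset.sum_congr rfl fun i _ => ?_
            rw [lintegral_const_mul _ (hm3 i z),
              lintegral_add_left (hm1 i t z)]
          simp_rw [e1]
          rw [lintegral_finsetSum _ fun i _ => (hm4 i).const_mul _]
          refine Finset.sum_congr rfl fun i _ => ?_
          rw [lintegral_const_mul _ (hm4 i),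
            lintegral_add_left (hm2 i t), hcoord, hcoord]
  have h3 : A + A ≤ ENNReal.ofReal (Real.exp (τ ^ 2 * L ^ 2 * κ * v))
      + ENNReal.ofReal (Real.exp (τ ^ 2 * L ^ 2 * κ * v)) := by
    refine h2.trans ?_
    have ht2 : t ^ 2 = τ ^ 2 * L ^ 2 * κ := by
      rw [ht, mul_pow, mul_pow, Real.sq_sqrt hκ'.le]
    have hb : ∀ i, S i i * t ^ 2 ≤ τ ^ 2 * L ^ 2 * κ * v := by
      intro i
      rw [← ht2, mul_comm]
      exact mul_le_mul_of_nonneg_left (hv i) (sq_nonneg _)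
    set B := ENNReal.ofReal (Real.exp (τ ^ 2 * L ^ 2 * κ * v))
    have hb' : ∀ i, ENNReal.ofReal (Real.exp (S i i * t ^ 2)) ≤ B := fun i =>
      ENNReal.ofReal_le_ofReal (Real.exp_le_exp.2 (hb i))
    calc _ ≤ ∑ i : Fin κ, ENNReal.ofReal (1 / (κ : ℝ)) * (B + B) := by
          refine Finset.sum_le_sum fun i _ => ?_
          rw [neg_sq]
          gcongr <;> exact hb' i
      _ = B + B := by
          rw [Finset.sum_const, Finset.card_univ, Fintype.card_fin, nsmul_eq_mul, ← mul_assoc,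
            ← ENNReal.ofReal_natCast, ← ENNReal.ofReal_mul hκ'.le, mul_one_div_cancel hκ'.ne',
            ENNReal.ofReal_one, one_mul]
  refine h1.trans ?_
  by_contra hlt
  push Not at hlt
  exact absurd h3 (not_le.2 (ENNReal.add_lt_add hlt hlt))

/-- `‖x‖ ≤ 1 + ‖x‖ ^ 2` reduces the claim to the trace of `S`, and `1 ≤ κ` absorbs the 1. -/
theorem integral_norm_sub_mean_multivariateGaussian_le (hκ : 1 ≤ κ) (hS : S.PosSemidef) {v : ℝ}
    (hv : ∀ i, S i i ≤ v) :
    ∫ z, ‖z - m‖ ∂(multivariateGaussian m S) ≤ κ * (1 + v) := by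
  have hκ' : (1 : ℝ) ≤ κ := by exact_mod_cast hκ
  have hml : MemLp (fun z : EuclideanSpace ℝ (Fin κ) => z - m) 2 (multivariateGaussian m S) :=
    IsGaussian.memLp_two_id.sub (memLp_const _)
  have hi1 : Integrable (fun z => ‖z - m‖) (multivariateGaussian m S) :=
    (hml.integrable (by norm_num)).norm
  have hi2 : ∀ i, Integrable (fun z : EuclideanSpace ℝ (Fin κ) => (z i - m i) ^ 2)
      (multivariateGaussian m S) := by
    intro i
    have : MemLp (fun z : EuclideanSpace ℝ (Fin κ) => z i - m i) 2 (multivariateGaussian m S) := by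
      simpa using hml.continuousLinearMap_comp (EuclideanSpace.proj (𝕜 := ℝ) i)
    exact this.integrable_sq
  calc ∫ z, ‖z - m‖ ∂(multivariateGaussian m S)
      ≤ ∫ z, (1 + ∑ i, (z i - m i) ^ 2) ∂(multivariateGaussian m S) := by
        refine integral_mono hi1 ((integrable_const _).add
          (integrable_finsetSum _ fun i _ => hi2 i)) fun z => ?_
        have := EuclideanSpace.real_norm_sq_eq (z - m)
        simp only [PiLp.sub_apply] at this
        simp only [← this]
        nlinarith [sq_nonneg (‖z - m‖ - 1), norm_nonneg (z - m)]
    _ = 1 + ∑ i, S i i := by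
        rw [integral_add (integrable_const _) (integrable_finsetSum _ fun i _ => hi2 i),
          integral_finsetSum _ fun i _ => hi2 i]
        simp only [integral_const, probReal_univ, smul_eq_mul, mul_one, add_right_inj]
        refine Finset.sum_congr rfl fun i _ => ?_
        rw [← variance_eval_multivariateGaussian (μ := m) hS i,
          variance_eq_integral (by fun_prop)]
        have hmp := measurePreserving_eval_multivariateGaussian (μ := m) hS (i := i)
        have : ∫ z, z i ∂(multivariateGaussian m S) = m i := by
          have h1 := integral_map (μ := multivariateGaussian m S) hmp.measurable.aemeasurable
            (f := fun y : ℝ => y) (by fun_prop)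
          rw [hmp.map_eq, integral_id_gaussianReal] at h1
          exact h1.symm
        rw [this]
    _ ≤ κ * (1 + v) := by
        have : ∑ i : Fin κ, S i i ≤ ∑ i : Fin κ, v := Finset.sum_le_sum fun i _ => hv i
        simp at this
        linarith

end Gaussian

/-! ### Lipschitz functions and Euclidean norms of data vectors. -/

section Lipschitz

variable {E : Type*} [NormedAddCommGroup E]

theorem continuous_of_abs_sub_le {f : E → ℝ} {L : ℝ} (hf : ∀ z z', |f z - f z'| ≤ L * ‖z - z'‖) :
    Continuous f := by
  refine (LipschitzWith.of_dist_le_mul (K := L.toNNReal) fun z z' => ?_).continuous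
  rw [Real.dist_eq, dist_eq_norm]
  exact (hf z z').trans (mul_le_mul_of_nonneg_right (Real.le_coe_toNNReal L) (norm_nonneg _))

variable [NormedSpace ℝ E] [MeasurableSpace E] [BorelSpace E] [SecondCountableTopology E]
  [CompleteSpace E]

theorem integrable_of_abs_sub_le {f : E → ℝ} {L : ℝ} (hf : ∀ z z', |f z - f z'| ≤ L * ‖z - z'‖)
    (ν : Measure E) [IsGaussian ν] : Integrable f ν := by
  have hi : Integrable (fun z : E => |f 0| + L * ‖z‖) ν :=
    (integrable_const _).add (IsGaussian.integrable_id.norm.const_mul _)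
  refine hi.mono' (continuous_of_abs_sub_le hf).aestronglyMeasurable (ae_of_all _ fun z => ?_)
  have h := hf z 0
  rw [sub_zero] at h
  rw [Real.norm_eq_abs]
  have := abs_sub_abs_le_abs_sub (f z) (f 0)
  linarith

end Lipschitz

theorem norm_toLp_append_sub_le {m n : ℕ} (y y' : Fin m → ℝ) (u u' : Fin n → ℝ) :
    ‖(WithLp.toLp 2 (Fin.append y u - Fin.append y' u') : EuclideanSpace ℝ (Fin (m + n)))‖
      ≤ ‖(WithLp.toLp 2 (y - y') : EuclideanSpace ℝ (Fin m))‖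
        + ‖(WithLp.toLp 2 (u - u') : EuclideanSpace ℝ (Fin n))‖ := by
  refine abs_le_of_sq_le_sq' ?_ (by positivity) |>.2
  rw [add_sq, EuclideanSpace.real_norm_sq_eq, EuclideanSpace.real_norm_sq_eq,
    EuclideanSpace.real_norm_sq_eq, Fin.sum_univ_add]
  simp only [Pi.sub_apply, Fin.append_left, Fin.append_right]
  have : 0 ≤ 2 * ‖(WithLp.toLp 2 (y - y') : EuclideanSpace ℝ (Fin m))‖
        * ‖(WithLp.toLp 2 (u - u') : EuclideanSpace ℝ (Fin n))‖ := by positivity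
  linarith

/-- The factor `n` in place of `√n` is affordable and keeps later powers of `κ` integral. -/
theorem norm_toLp_le_mul {n : ℕ} (hn : 1 ≤ n) (u : Fin n → ℝ) {b : ℝ} (hu : ∀ i, |u i| ≤ b) :
    ‖(WithLp.toLp 2 u : EuclideanSpace ℝ (Fin n))‖ ≤ n * b := by
  have hb : 0 ≤ b := (abs_nonneg _).trans (hu ⟨0, hn⟩)
  have hn' : (1 : ℝ) ≤ n := by exact_mod_cast hn
  refine abs_le_of_sq_le_sq' ?_ (by positivity) |>.2
  rw [EuclideanSpace.real_norm_sq_eq]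
  calc ∑ i, u i ^ 2 ≤ ∑ _i : Fin n, b ^ 2 :=
        Finset.sum_le_sum fun i _ => sq_le_sq' (abs_le.1 (hu i)).1 (abs_le.1 (hu i)).2
    _ = n * b ^ 2 := by simp
    _ ≤ (n * b) ^ 2 := by
      rw [mul_pow]
      have : (n : ℝ) ≤ n ^ 2 := by nlinarith
      gcongr

/-! ### Estimates for the Gaussian process posterior. -/

namespace MacroGPO

variable {S : Type u} {κ : ℕ} (P : MacroGPO S κ)

theorem crossCov_posSemidef {n : ℕ} (s : Fin n → S) : (P.crossCov s s).PosSemidef :=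
  P.cov_posSemidef.submatrix s

theorem noisyCov_posDef {n : ℕ} (s : Fin n → S) : (P.noisyCov s).PosDef :=
  Matrix.PosDef.posSemidef_add (P.crossCov_posSemidef s)
    (Matrix.PosDef.one.smul P.noiseVar_pos)

theorem cov_comm (x y : S) : P.cov x y = P.cov y x := by
  simpa using (P.cov_posSemidef.isHermitian.apply x y).symm

theorem crossCov_transpose {m n : ℕ} (a : Fin m → S) (b : Fin n → S) :
    (P.crossCov a b).conjTranspose = P.crossCov b a := by
  ext i j
  simp [crossCov, P.cov_comm]

/-- It is the Schur complement in the joint covariance of old and new measurements. -/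
theorem postCov_posSemidef (d : History S) (a : MacroAction S κ) : (P.postCov d a).PosSemidef := by
  classical
  have hD := P.noisyCov_posDef d.loc
  let _ : Invertible (P.noisyCov d.loc) := hD.isUnit.invertible
  have h := (Matrix.PosDef.fromBlocks₂₂ (P.noisyCov a) (P.crossCov a d.loc) hD).1 ?_
  · rw [crossCov_transpose] at h
    exact h
  · rw [crossCov_transpose]
    -- The noise is the identity on the disjoint union of indices, so measurements repeated at one
    -- location still have independent noise.
    have e : Matrix.fromBlocks (P.noisyCov a) (P.crossCov a d.loc) (P.crossCov d.loc a)
        (P.noisyCov d.loc) = P.cov.submatrix (Sum.elim a d.loc) (Sum.elim a d.loc)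
          + P.noiseVar • (1 : Matrix (Fin κ ⊕ Fin d.len) (Fin κ ⊕ Fin d.len) ℝ) := by
      ext (i | i) (j | j) <;> simp [noisyCov, crossCov, Matrix.one_apply]
    rw [e]
    exact (P.cov_posSemidef.submatrix _).add (Matrix.PosSemidef.one.smul P.noiseVar_pos.le)

/-- Conditioning only subtracts a positive semidefinite matrix. -/
theorem postCov_diag_le (d : History S) (a : MacroAction S κ) {Y : ℝ} (hY : ∀ s, P.cov s s ≤ Y)
    (i : Fin κ) : P.postCov d a i i ≤ Y + P.noiseVar := by
  have h : (P.crossCov a d.loc * (P.noisyCov d.loc)⁻¹ * P.crossCov d.loc a).PosSemidef := by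
    rw [← P.crossCov_transpose a d.loc]
    exact (P.noisyCov_posDef d.loc).inv.posSemidef.mul_mul_conjTranspose_same _
  have h1 := h.diag_nonneg (i := i)
  have h2 : P.noisyCov a i i = P.cov (a i) (a i) + P.noiseVar := by
    simp [noisyCov, crossCov]
  have h3 := hY (a i)
  rw [postCov, Matrix.sub_apply, h2]
  linarith

/-- With `w` the gain row, `G` the Gram matrix of `s` and `k` the covariances of `a i` with `s`, one
has `k = w (G + noiseVar I)`. The residual variance of predicting the noiseless value at `a i` by
`w` is nonnegative; substituting `k` gives `w G wᵀ + 2 * noiseVar * |w| ^ 2 ≤ cov (a i) (a i)`,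
which is more than needed. -/
theorem sum_sq_gain_le {n : ℕ} (s : Fin n → S) (a : MacroAction S κ) {Y : ℝ}
    (hY : ∀ s, P.cov s s ≤ Y) (i : Fin κ) :
    ∑ j, ((P.crossCov a s * (P.noisyCov s)⁻¹) i j) ^ 2 ≤ Y / P.noiseVar := by
  set w : Fin n → ℝ := fun j => (P.crossCov a s * (P.noisyCov s)⁻¹) i j with hw
  have hD := P.noisyCov_posDef s
  have hk : ∀ j, P.cov (a i) (s j) = ∑ l, w l * P.cov (s l) (s j) + P.noiseVar * w j := by
    intro j
    have : P.crossCov a s * (P.noisyCov s)⁻¹ * P.noisyCov s = P.crossCov a s := by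
      rw [Matrix.mul_assoc, Matrix.nonsing_inv_mul _ ((Matrix.isUnit_iff_isUnit_det _).1 hD.isUnit),
        Matrix.mul_one]
    have h := congrFun (congrFun this i) j
    rw [Matrix.mul_apply] at h
    simp only [noisyCov, Matrix.add_apply, Matrix.smul_apply, Matrix.one_apply, smul_eq_mul,
      mul_add, Finset.sum_add_distrib] at h
    simp only [mul_ite, mul_one, mul_zero, Finset.sum_ite_eq', Finset.mem_univ, if_true] at h
    simp only [crossCov, Matrix.of_apply] at h
    rw [← h, mul_comm P.noiseVar]
    rfl
  -- The coefficients `(-1, w)` are those of the prediction residual.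
  have hq := (P.cov_posSemidef.submatrix (Sum.elim (fun _ : Unit => a i) s)).dotProduct_mulVec_nonneg
    (Sum.elim (fun _ : Unit => -1) w)
  simp only [star_trivial, dotProduct, Matrix.mulVec, Fintype.sum_sum_type, Sum.elim_inl,
    Sum.elim_inr, Matrix.submatrix_apply, Finset.univ_unique, Finset.sum_singleton] at hq
  have e1 : ∑ j, P.cov (a i) (s j) * w j
      = ∑ j, w j * ∑ l, P.cov (s j) (s l) * w l + P.noiseVar * ∑ j, w j ^ 2 := by
    simp_rw [hk, add_mul, Finset.sum_add_distrib, Finset.mul_sum, Finset.sum_mul]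
    congr 1
    · rw [Finset.sum_comm]
      exact Finset.sum_congr rfl fun _ _ => Finset.sum_congr rfl fun _ _ => by ring
    · exact Finset.sum_congr rfl fun _ _ => by ring
  have e2 : ∑ j, w j * (P.cov (s j) (a i) * -1 + ∑ l, P.cov (s j) (s l) * w l)
      = - ∑ j, P.cov (a i) (s j) * w j + ∑ j, w j * ∑ l, P.cov (s j) (s l) * w l := by
    simp_rw [mul_add, Finset.sum_add_distrib, P.cov_comm _ (a i)]
    congr 1
    rw [← Finset.sum_neg_distrib]
    exact Finset.sum_congr rfl fun _ _ => by ring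
  rw [e2] at hq
  have hquad := (P.crossCov_posSemidef s).dotProduct_mulVec_nonneg w
  simp only [star_trivial, dotProduct, Matrix.mulVec, crossCov, Matrix.of_apply] at hquad
  have hs : 0 ≤ ∑ j, w j ^ 2 := Finset.sum_nonneg fun _ _ => sq_nonneg _
  have hmul := mul_nonneg P.noiseVar_pos.le hs
  rw [le_div_iff₀ P.noiseVar_pos]
  have := hY (a i)
  linarith

theorem abs_postMean_sub_le {n : ℕ} (hn : 0 < n) (s : Fin n → S) (y y' : Fin n → ℝ)
    (a : MacroAction S κ) {Y : ℝ} (hY : ∀ s, P.cov s s ≤ Y) (i : Fin κ) :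
    |P.postMean ⟨n, hn, s, y⟩ a i - P.postMean ⟨n, hn, s, y'⟩ a i|
      ≤ √(Y / P.noiseVar) * ‖(WithLp.toLp 2 (y - y') : EuclideanSpace ℝ (Fin n))‖ := by
  set w : Fin n → ℝ := fun j => (P.crossCov a s * (P.noisyCov s)⁻¹) i j with hw
  have h : P.postMean ⟨n, hn, s, y⟩ a i - P.postMean ⟨n, hn, s, y'⟩ a i
      = ∑ j, w j * (y - y') j := by
    simp only [postMean, Matrix.mulVec, dotProduct, hw, Pi.sub_apply, mul_sub,
      Finset.sum_sub_distrib]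
  have hb := P.sum_sq_gain_le s a hY i
  rw [h]
  apply Real.abs_le_sqrt (y := Y / P.noiseVar * ∑ j, (y - y') j ^ 2) _ |>.trans_eq
  · rw [Real.sqrt_mul' _ (Finset.sum_nonneg fun _ _ => sq_nonneg _), EuclideanSpace.norm_eq]
    simp
  · refine (Finset.sum_mul_sq_le_sq_mul_sq _ _ _).trans ?_
    exact mul_le_mul_of_nonneg_right hb (Finset.sum_nonneg fun _ _ => sq_nonneg _)

theorem abs_reward_sub_le {n : ℕ} (hn : 0 < n) (s : Fin n → S) (y y' : Fin n → ℝ)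
    (a : MacroAction S κ) {Y : ℝ} (hY : ∀ s, P.cov s s ≤ Y) :
    |P.reward ⟨n, hn, s, y⟩ a - P.reward ⟨n, hn, s, y'⟩ a|
      ≤ κ * (√(Y / P.noiseVar) * ‖(WithLp.toLp 2 (y - y') : EuclideanSpace ℝ (Fin n))‖) := by
  have : P.reward ⟨n, hn, s, y⟩ a - P.reward ⟨n, hn, s, y'⟩ a
      = ∑ i, (P.postMean ⟨n, hn, s, y⟩ a i - P.postMean ⟨n, hn, s, y'⟩ a i) := by
    rw [Finset.sum_sub_distrib]
    exact add_sub_add_right_eq_sub _ _ _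
  rw [this]
  refine (Finset.abs_sum_le_sum_abs _ _).trans ((Finset.sum_le_sum fun i _ =>
    P.abs_postMean_sub_le hn s y y' a hY i).trans_eq ?_)
  simp

/-- The square root of the posterior covariance depends on locations only and cancels. This is the
coupling behind all Lipschitz estimates. -/
theorem sample_sub_sample {n : ℕ} (hn : 0 < n) (s : Fin n → S) (y y' : Fin n → ℝ)
    (a : MacroAction S κ) (x : EuclideanSpace ℝ (Fin κ)) :
    P.sample ⟨n, hn, s, y⟩ a x - P.sample ⟨n, hn, s, y'⟩ a x
      = P.postMean ⟨n, hn, s, y⟩ a - P.postMean ⟨n, hn, s, y'⟩ a :=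
  add_sub_add_right_eq_sub _ _ _

theorem measurable_sample (d : History S) (a : MacroAction S κ) : Measurable (P.sample d a) := by
  unfold sample
  fun_prop

theorem continuous_postMean {n : ℕ} (hn : 0 < n) (s : Fin n → S) (a : MacroAction S κ) :
    Continuous fun y : Fin n → ℝ => P.postMean ⟨n, hn, s, y⟩ a := by
  unfold postMean
  refine (PiLp.continuous_toLp 2 _).comp ?_
  exact (Matrix.mulVecLin (P.crossCov a s * (P.noisyCov s)⁻¹)).continuous_of_finiteDimensional

theorem continuous_sample {n : ℕ} (hn : 0 < n) (s : Fin n → S) (a : MacroAction S κ) :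
    Continuous fun p : (Fin n → ℝ) × EuclideanSpace ℝ (Fin κ) =>
      P.sample ⟨n, hn, s, p.1⟩ a p.2 := by
  have hc : Continuous fun x => P.sample ⟨n, hn, s, 0⟩ a x - P.postMean ⟨n, hn, s, 0⟩ a := by
    unfold sample
    fun_prop
  have e : (fun p : (Fin n → ℝ) × EuclideanSpace ℝ (Fin κ) => P.sample ⟨n, hn, s, p.1⟩ a p.2)
      = fun p => P.postMean ⟨n, hn, s, p.1⟩ a
        + (P.sample ⟨n, hn, s, 0⟩ a p.2 - P.postMean ⟨n, hn, s, 0⟩ a) := by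
    funext p
    have := P.sample_sub_sample hn s p.1 0 a p.2
    rw [sub_eq_iff_eq_add] at this
    rw [this]
    abel
  rw [e]
  exact ((P.continuous_postMean hn s a).comp continuous_fst).add (hc.comp continuous_snd)

theorem continuous_reward {n : ℕ} (hn : 0 < n) (s : Fin n → S) (a : MacroAction S κ) :
    Continuous fun y : Fin n → ℝ => P.reward ⟨n, hn, s, y⟩ a := by
  unfold reward
  have hc : Continuous fun _ : Fin n → ℝ => (1 / 2) * P.weight
      * Real.log (1 + P.noiseVar⁻¹ • P.postCov ⟨n, hn, s, 0⟩ a).det := continuous_const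
  refine Continuous.add (continuous_finsetSum _ fun i _ => ?_) hc
  exact (PiLp.continuous_apply 2 _ i).comp (P.continuous_postMean hn s a)

instance isGaussian_belief (d : History S) (a : MacroAction S κ) : IsGaussian (P.belief d a) := by
  unfold belief
  infer_instance

theorem integral_belief {f : EuclideanSpace ℝ (Fin κ) → ℝ} (hf : Measurable f) (d : History S)
    (a : MacroAction S κ) :
    ∫ z, f z ∂(P.belief d a) = ∫ x, f (P.sample d a x) ∂(stdGaussian (EuclideanSpace ℝ (Fin κ))) := by
  rw [← P.map_sample, integral_map (P.measurable_sample d a).aemeasurable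
    hf.aestronglyMeasurable]

theorem integrable_belief_iff {f : EuclideanSpace ℝ (Fin κ) → ℝ} (hf : Measurable f)
    (d : History S) (a : MacroAction S κ) :
    Integrable f (P.belief d a)
      ↔ Integrable (fun x => f (P.sample d a x)) (stdGaussian (EuclideanSpace ℝ (Fin κ))) := by
  rw [← P.map_sample, integrable_map_measure hf.aestronglyMeasurable
    (P.measurable_sample d a).aemeasurable]
  rfl

end MacroGPO

/-! ### Lipschitz continuity of the optimal value and the error of most likely observations. -/

/-- The coefficients of the Lipschitz constants of the optimal values. -/
def lipCoeff (L : ℝ) : ℕ → ℝ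
  | 0 => 0
  | r + 1 => L + (1 + L) * lipCoeff L r

theorem lipCoeff_nonneg {L : ℝ} (hL : 0 ≤ L) (r : ℕ) : 0 ≤ lipCoeff L r := by
  induction r with
  | zero => exact le_rfl
  | succ r ih => unfold lipCoeff; positivity

theorem lipCoeff_mono {L : ℝ} (hL : 0 ≤ L) : Monotone (lipCoeff L) := by
  refine monotone_nat_of_le_succ fun r => ?_
  have := lipCoeff_nonneg hL r
  change _ ≤ L + (1 + L) * lipCoeff L r
  nlinarith

namespace MacroGPO

variable {S : Type u} {κ : ℕ} (P : MacroGPO S κ)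

/-- A function of the data that is Lipschitz in the measurements for the Euclidean norm. -/
def LipschitzInOut (f : History S → ℝ) (K : ℝ) : Prop :=
  ∀ (n : ℕ) (hn : 0 < n) (s : Fin n → S) (y y' : Fin n → ℝ),
    |f ⟨n, hn, s, y⟩ - f ⟨n, hn, s, y'⟩|
      ≤ K * ‖(WithLp.toLp 2 (y - y') : EuclideanSpace ℝ (Fin n))‖

namespace LipschitzInOut

variable {f : History S → ℝ} {K : ℝ}

theorem continuous (hf : LipschitzInOut f K) {n : ℕ} (hn : 0 < n) (s : Fin n → S) :
    Continuous fun y : Fin n → ℝ => f ⟨n, hn, s, y⟩ := by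
  have : Continuous fun z : EuclideanSpace ℝ (Fin n) => f ⟨n, hn, s, z.ofLp⟩ :=
    continuous_of_abs_sub_le fun z z' => hf n hn s z.ofLp z'.ofLp
  exact this.comp (PiLp.continuous_toLp 2 _)

theorem abs_extend_sub_le (hf : LipschitzInOut f K) (d : History S) (a : MacroAction S κ)
    (z z' : EuclideanSpace ℝ (Fin κ)) :
    |f (d.extend a z) - f (d.extend a z')| ≤ K * ‖z - z'‖ := by
  refine (hf _ _ _ _ _).trans_eq ?_
  congr 1
  rw [← sq_eq_sq₀ (norm_nonneg _) (norm_nonneg _), EuclideanSpace.real_norm_sq_eq,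
    EuclideanSpace.real_norm_sq_eq, Fin.sum_univ_add]
  simp

theorem measurable_extend (hf : LipschitzInOut f K) (d : History S) (a : MacroAction S κ) :
    Measurable fun z => f (d.extend a z) :=
  (continuous_of_abs_sub_le (hf.abs_extend_sub_le d a)).measurable

theorem integrable_extend (hf : LipschitzInOut f K) (d d' : History S) (a : MacroAction S κ) :
    Integrable (fun z => f (d'.extend a z)) (P.belief d a) :=
  integrable_of_abs_sub_le (hf.abs_extend_sub_le d' a) _

end LipschitzInOut

/-- Moving the data by `δ` moves the reward by at most `κ * L * δ`. With the two beliefs coupled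
through the same Gaussian vector, the extended data move by at most `δ + κ * L * δ`. Since `1 ≤ κ`,
each stage costs one power of `κ`, which gives the recursion of `lipCoeff`. -/
theorem lipschitzInOut_optV (hκ : 1 ≤ κ) {Y : ℝ} (hY : ∀ s, P.cov s s ≤ Y) (r : ℕ) :
    LipschitzInOut (P.optV r) (lipCoeff √(Y / P.noiseVar) r * κ ^ r) := by
  set L := √(Y / P.noiseVar)
  have hL : 0 ≤ L := Real.sqrt_nonneg _
  have hκ' : (1 : ℝ) ≤ κ := by exact_mod_cast hκ
  induction r with
  | zero => intro n hn s y y'; simp [optV, lipCoeff]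
  | succ r ih =>
    intro n hn s y y'
    set δ := ‖(WithLp.toLp 2 (y - y') : EuclideanSpace ℝ (Fin n))‖ with hδ
    have hδ0 : 0 ≤ δ := norm_nonneg _
    have hC := lipCoeff_nonneg hL r
    refine Finset.abs_sup'_sub_sup'_le _ fun a _ => ?_
    have h1 := P.abs_reward_sub_le hn s y y' a hY
    have h2 : |∫ z, P.optV r (History.extend ⟨n, hn, s, y⟩ a z) ∂(P.belief ⟨n, hn, s, y⟩ a)
        - ∫ z, P.optV r (History.extend ⟨n, hn, s, y'⟩ a z) ∂(P.belief ⟨n, hn, s, y'⟩ a)|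
        ≤ lipCoeff L r * κ ^ r * (δ + κ * (L * δ)) := by
      have i1 := (P.integrable_belief_iff (ih.measurable_extend ⟨n, hn, s, y⟩ a) _ _).1
        (ih.integrable_extend P ⟨n, hn, s, y⟩ ⟨n, hn, s, y⟩ a)
      have i2 := (P.integrable_belief_iff (ih.measurable_extend ⟨n, hn, s, y'⟩ a) _ _).1
        (ih.integrable_extend P ⟨n, hn, s, y'⟩ ⟨n, hn, s, y'⟩ a)
      rw [P.integral_belief (ih.measurable_extend _ _), P.integral_belief (ih.measurable_extend _ _),
        ← integral_sub i1 i2, ← Real.norm_eq_abs]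
      refine (norm_integral_le_of_norm_le_const (C := lipCoeff L r * κ ^ r * (δ + κ * (L * δ)))
        (ae_of_all _ fun x => ?_)).trans_eq (by simp)
      rw [Real.norm_eq_abs]
      refine (ih _ _ _ _ _).trans ?_
      refine mul_le_mul_of_nonneg_left ((norm_toLp_append_sub_le _ _ _ _).trans ?_) (by positivity)
      refine add_le_add_right (norm_toLp_le_mul hκ _ fun i => ?_) _
      have := P.abs_postMean_sub_le hn s y y' a hY i
      have e := congrArg (fun z : EuclideanSpace ℝ (Fin κ) => z i) (P.sample_sub_sample hn s y y' a x)
      simp only [PiLp.sub_apply] at e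
      simpa only [Pi.sub_apply, e] using this
    have h3 := abs_add_le
      (P.reward ⟨n, hn, s, y⟩ a - P.reward ⟨n, hn, s, y'⟩ a)
      (∫ z, P.optV r (History.extend ⟨n, hn, s, y⟩ a z) ∂(P.belief ⟨n, hn, s, y⟩ a)
        - ∫ z, P.optV r (History.extend ⟨n, hn, s, y'⟩ a z) ∂(P.belief ⟨n, hn, s, y'⟩ a))
    rw [add_sub_add_comm]
    refine h3.trans ((add_le_add h1 h2).trans ?_)
    change _ ≤ (L + (1 + L) * lipCoeff L r) * κ ^ (r + 1) * δ
    have hpow : (1 : ℝ) ≤ κ ^ r := one_le_pow₀ hκ'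
    have a1 : κ * (L * δ) ≤ L * κ ^ (r + 1) * δ := by
      rw [pow_succ]
      have : L * δ * κ * 1 ≤ L * δ * κ * κ ^ r := by gcongr
      nlinarith
    have a2 : lipCoeff L r * κ ^ r * (δ + κ * (L * δ))
        ≤ (1 + L) * lipCoeff L r * κ ^ (r + 1) * δ := by
      rw [pow_succ]
      have : lipCoeff L r * κ ^ r * (1 * δ + κ * (L * δ))
        ≤ lipCoeff L r * κ ^ r * (κ * δ + κ * (L * δ)) := by gcongr
      nlinarith
    nlinarith

/-- A bound of the error caused by replacing future measurements by their posterior means. -/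
def mlBound (L v : ℝ) (κ r : ℕ) : ℝ :=
  ∑ j ∈ Finset.range r, lipCoeff L j * κ ^ j * (κ * (1 + v))

theorem abs_integral_optV_sub_le (hκ : 1 ≤ κ) {Y : ℝ} (hY : ∀ s, P.cov s s ≤ Y) (r : ℕ)
    (d : History S) (a : MacroAction S κ) :
    |P.optV r (d.extend a (P.postMean d a)) - ∫ z, P.optV r (d.extend a z) ∂(P.belief d a)|
      ≤ lipCoeff √(Y / P.noiseVar) r * κ ^ r * (κ * (1 + (Y + P.noiseVar))) := by
  have hL : 0 ≤ √(Y / P.noiseVar) := Real.sqrt_nonneg _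
  have hlip := P.lipschitzInOut_optV hκ hY r
  have hC := lipCoeff_nonneg hL r
  have hm : ∫ z, ‖z - P.postMean d a‖ ∂(P.belief d a) ≤ κ * (1 + (Y + P.noiseVar)) :=
    integral_norm_sub_mean_multivariateGaussian_le hκ (P.postCov_posSemidef d a)
      (P.postCov_diag_le d a hY)
  have hi := hlip.integrable_extend P d d a
  have hn : Integrable (fun z => ‖z - P.postMean d a‖) (P.belief d a) :=
    (IsGaussian.integrable_id.sub (integrable_const _)).norm
  have e : P.optV r (d.extend a (P.postMean d a)) - ∫ z, P.optV r (d.extend a z) ∂(P.belief d a)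
      = ∫ z, (P.optV r (d.extend a (P.postMean d a)) - P.optV r (d.extend a z)) ∂(P.belief d a) := by
    rw [integral_sub (integrable_const _) hi]; simp
  rw [e, ← Real.norm_eq_abs]
  refine (norm_integral_le_of_norm_le (hn.const_mul (lipCoeff √(Y / P.noiseVar) r * κ ^ r))
    (ae_of_all _ fun z => ?_)).trans ?_
  · rw [Real.norm_eq_abs, norm_sub_rev]
    exact hlip.abs_extend_sub_le d a _ _
  · rw [integral_const_mul]
    gcongr

/-- Inserting `optV` at the mean-extended data separates the error inherited from later stages from
that of the current replacement, so errors add. -/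
theorem abs_mlV_sub_optV_le (hκ : 1 ≤ κ) {Y : ℝ} (hY : ∀ s, P.cov s s ≤ Y) (r : ℕ)
    (d : History S) :
    |P.mlV r d - P.optV r d| ≤ mlBound √(Y / P.noiseVar) (Y + P.noiseVar) κ r := by
  induction r generalizing d with
  | zero => simp [mlV, optV, mlBound]
  | succ r ih =>
    refine Finset.abs_sup'_sub_sup'_le _ fun a _ => ?_
    rw [add_sub_add_left_eq_sub, mlBound, Finset.sum_range_succ]
    have h1 := ih (d.extend a (P.postMean d a))
    have h2 := P.abs_integral_optV_sub_le hκ hY r d a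
    refine (abs_sub_le _ (P.optV r (d.extend a (P.postMean d a))) _).trans (add_le_add h1 h2)

theorem abs_mlQ_sub_optQ_le (hκ : 1 ≤ κ) {Y : ℝ} (hY : ∀ s, P.cov s s ≤ Y) (r : ℕ)
    (d : History S) (a : MacroAction S κ) :
    |P.mlQ r d a - P.optQ r d a| ≤ mlBound √(Y / P.noiseVar) (Y + P.noiseVar) κ (r + 1) := by
  rw [mlQ, optQ, add_sub_add_left_eq_sub, mlBound, Finset.sum_range_succ]
  exact (abs_sub_le _ (P.optV r (d.extend a (P.postMean d a))) _).trans
    (add_le_add (P.abs_mlV_sub_optV_le hκ hY r _) (P.abs_integral_optV_sub_le hκ hY r d a))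

theorem mlBound_le {L v : ℝ} (hL : 0 ≤ L) (hv : 0 ≤ v) (hκ : 1 ≤ κ) {r H : ℕ} (hr : r ≤ H) :
    mlBound L v κ r ≤ H * (lipCoeff L H * (1 + v)) * κ ^ H := by
  have hκ' : (1 : ℝ) ≤ κ := by exact_mod_cast hκ
  calc mlBound L v κ r ≤ ∑ j ∈ Finset.range r, lipCoeff L H * (1 + v) * κ ^ H := by
        refine Finset.sum_le_sum fun j hj => ?_
        have hj' : j + 1 ≤ H := (Finset.mem_range.1 hj).trans_le hr
        have h1 : lipCoeff L j ≤ lipCoeff L H := lipCoeff_mono hL (by lia)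
        have h2 : (κ : ℝ) ^ (j + 1) ≤ κ ^ H := pow_le_pow_right₀ hκ' hj'
        have h3 := lipCoeff_nonneg hL j
        have h4 := lipCoeff_nonneg hL H
        calc lipCoeff L j * κ ^ j * (κ * (1 + v)) = lipCoeff L j * (1 + v) * κ ^ (j + 1) := by ring
          _ ≤ _ := by gcongr
    _ = r * (lipCoeff L H * (1 + v) * κ ^ H) := by simp
    _ ≤ H * (lipCoeff L H * (1 + v) * κ ^ H) := by
        have h4 := lipCoeff_nonneg hL H
        gcongr
    _ = _ := by ring

end MacroGPO

/-! ### Exponential moments of the sampling error in the planning tree. -/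

namespace MacroGPO

variable {S : Type u} {κ N : ℕ} (P : MacroGPO S κ)

instance : IsProbabilityMeasure (seedMeasure S κ N) := by
  unfold seedMeasure; infer_instance

instance : IsProbabilityMeasure (runMeasure S κ N) := by
  unfold runMeasure; infer_instance

/-- The randomness of the subtree below the `l`-th sample for the macro-action `a`. -/
def subSeed (a : MacroAction S κ) (l : Fin N) (ω : Seed S κ N) : Seed S κ N :=
  fun p => ω ((a, l) :: p)

theorem measurable_subSeed (a : MacroAction S κ) (l : Fin N) :
    Measurable (subSeed a l : Seed S κ N → Seed S κ N) :=
  measurable_pi_lambda _ fun _ => measurable_pi_apply _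

/-- For a fixed `a`, the nodes `(a, l) :: p` are distinct for distinct `(l, p)`, so the sub-seeds
are independent copies of the whole seed. Independence across different `a` is never needed. -/
theorem map_subSeed (a : MacroAction S κ) :
    (seedMeasure S κ N).map (fun ω l => subSeed a l ω)
      = Measure.pi fun _ : Fin N => seedMeasure S κ N := by
  have hinj : Function.Injective
      fun q : Fin N × List (MacroAction S κ × Fin N) => (a, q.1) :: q.2 := by
    rintro ⟨l, p⟩ ⟨l', p'⟩ h
    simpa using h
  have h1 := Measure.map_infinitePi_infinitePi_of_inj
    (P := fun _ : List (MacroAction S κ × Fin N) => stdGaussian (EuclideanSpace ℝ (Fin κ))) hinj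
  have h2 := Measure.infinitePi_map_curry
    (fun (_ : Fin N) (_ : List (MacroAction S κ × Fin N)) =>
      stdGaussian (EuclideanSpace ℝ (Fin κ)))
  rw [← h1, Measure.map_map (by fun_prop) (by fun_prop)] at h2
  rw [← Measure.infinitePi_eq_pi]
  exact h2

theorem lintegral_prod_subSeed (a : MacroAction S κ) {g : Seed S κ N → ENNReal}
    (hg : Measurable g) :
    ∫⁻ ω, ∏ l, g (subSeed a l ω) ∂(seedMeasure S κ N) = (∫⁻ ω, g ω ∂(seedMeasure S κ N)) ^ N := by
  have hm : Measurable fun (ω : Seed S κ N) (l : Fin N) => subSeed a l ω :=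
    measurable_pi_lambda _ fun l => measurable_subSeed a l
  have h := lintegral_map (μ := seedMeasure S κ N)
    (f := fun η : Fin N → Seed S κ N => ∏ l, g (η l))
    (Finset.measurable_fun_prod _ fun l _ => hg.comp (measurable_pi_apply l)) hm
  rw [← h, map_subSeed]
  refine (lintegral_prod_eq_prod_lintegral_of_indepFun Finset.univ
    (fun l (η : Fin N → Seed S κ N) => g (η l))
    (iIndepFun_pi (X := fun _ => g) fun _ => hg.aemeasurable)
    fun l => hg.comp (measurable_pi_apply l)).trans ?_
  have : ∀ l : Fin N, ∫⁻ η, g (η l) ∂(Measure.pi fun _ : Fin N => seedMeasure S κ N)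
      = ∫⁻ ω, g ω ∂(seedMeasure S κ N) := fun l =>
    (measurePreserving_eval (fun _ : Fin N => seedMeasure S κ N) l).lintegral_comp hg
  simp [this]

/-- The root of `subSeed a l ω` is the vector `ω [(a, l)]` that generates the `l`-th observation,
while the subtree value does not read it (`sampV_congr_of_ne_nil`). Observation and subtree can
therefore be integrated separately. -/
theorem lintegral_root {g : EuclideanSpace ℝ (Fin κ) × Seed S κ N → ENNReal} (hg : Measurable g)
    (hroot : ∀ x ω ω', (∀ p, p ≠ [] → ω p = ω' p) → g (x, ω) = g (x, ω')) :
    ∫⁻ ω, g (ω [], ω) ∂(seedMeasure S κ N)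
      = ∫⁻ x, ∫⁻ ω, g (x, ω) ∂(seedMeasure S κ N) ∂(stdGaussian (EuclideanSpace ℝ (Fin κ))) := by
  classical
  have h : seedMeasure S κ N = _ := (Measure.map_update_infinitePi
    (stdGaussian (EuclideanSpace ℝ (Fin κ))) ([] : List (MacroAction S κ × Fin N))).symm
  conv_lhs => rw [h]
  have hg' : Measurable fun ω : Seed S κ N => g (ω [], ω) :=
    hg.comp ((measurable_pi_apply _).prodMk measurable_id)
  rw [lintegral_map hg' (measurable_update_prod _)]
  have : ∀ q : Seed S κ N × EuclideanSpace ℝ (Fin κ),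
      g (Function.update q.1 [] q.2 [], Function.update q.1 [] q.2) = g (q.2, q.1) := by
    intro q
    rw [Function.update_self]
    exact hroot _ _ _ fun p hp => Function.update_of_ne hp _ _
  refine (lintegral_congr this).trans ?_
  exact lintegral_prod_symm (fun q : Seed S κ N × EuclideanSpace ℝ (Fin κ) => g (q.2, q.1))
    (hg.comp measurable_swap).aemeasurable

theorem sampV_succ (r : ℕ) (d : History S) (ω : Seed S κ N) :
    P.sampV (r + 1) d ω = (P.actions d.current).sup' (P.actions_nonempty _) fun a =>
      P.sampQ r d a ω := rfl

theorem optV_succ (r : ℕ) (d : History S) :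
    P.optV (r + 1) d = (P.actions d.current).sup' (P.actions_nonempty _) fun a =>
      P.optQ r d a := rfl

theorem sampV_congr_of_ne_nil (r : ℕ) (d : History S) {ω ω' : Seed S κ N}
    (h : ∀ p, p ≠ [] → ω p = ω' p) : P.sampV r d ω = P.sampV r d ω' := by
  cases r with
  | zero => rfl
  | succ r =>
    have e : ∀ (a : MacroAction S κ) (l : Fin N),
        (fun p => ω ((a, l) :: p)) = fun p => ω' ((a, l) :: p) :=
      fun a l => funext fun p => h _ (List.cons_ne_nil _ _)
    have e' : ∀ (a : MacroAction S κ) (l : Fin N), ω [(a, l)] = ω' [(a, l)] :=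
      fun a l => h _ (List.cons_ne_nil _ _)
    rw [sampV, sampV]
    simp_rw [e, e']

theorem measurable_append {n : ℕ} :
    Measurable fun p : (Fin n → ℝ) × EuclideanSpace ℝ (Fin κ) =>
      (Fin.append p.1 fun i => p.2 i : Fin (n + κ) → ℝ) := by
  refine measurable_pi_lambda _ fun i => ?_
  refine Fin.addCases (fun i => ?_) (fun i => ?_) i
  · simp only [Fin.append_left]; fun_prop
  · simp only [Fin.append_right]; fun_prop

theorem measurable_sampQ_of_sampV {r : ℕ}
    (ih : ∀ (n : ℕ) (hn : 0 < n) (s : Fin n → S),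
      Measurable fun p : (Fin n → ℝ) × Seed S κ N => P.sampV r ⟨n, hn, s, p.1⟩ p.2)
    (n : ℕ) (hn : 0 < n) (s : Fin n → S) (a : MacroAction S κ) :
    Measurable fun p : (Fin n → ℝ) × Seed S κ N => P.sampQ r ⟨n, hn, s, p.1⟩ a p.2 := by
  unfold sampQ
  refine ((P.continuous_reward hn s a).measurable.comp measurable_fst).add
    (Measurable.const_mul (Finset.measurable_fun_sum _ fun l _ => ?_) _)
  have h0 : Measurable fun p : (Fin n → ℝ) × Seed S κ N => p.2 [(a, l)] :=
    (measurable_pi_apply [(a, l)]).comp measurable_snd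
  have h1 : Measurable fun p : (Fin n → ℝ) × Seed S κ N =>
      (Fin.append p.1 fun i => P.sample ⟨n, hn, s, p.1⟩ a (p.2 [(a, l)]) i : Fin (n + κ) → ℝ) :=
    measurable_append.comp (measurable_fst.prodMk
      ((P.continuous_sample hn s a).measurable.comp
        (measurable_fst.prodMk h0)))
  exact (ih (n + κ) (by lia) (Fin.append s a)).comp
    (h1.prodMk ((measurable_subSeed a l).comp measurable_snd))

theorem measurable_sampV (r : ℕ) (n : ℕ) (hn : 0 < n) (s : Fin n → S) :
    Measurable fun p : (Fin n → ℝ) × Seed S κ N => P.sampV r ⟨n, hn, s, p.1⟩ p.2 := by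
  induction r generalizing n with
  | zero => exact measurable_const
  | succ r ih =>
    have h := Finset.measurable_sup' (P.actions_nonempty (s ⟨n - 1, by lia⟩))
      (f := fun a (p : (Fin n → ℝ) × Seed S κ N) => P.sampQ r ⟨n, hn, s, p.1⟩ a p.2)
      fun a _ => P.measurable_sampQ_of_sampV ih n hn s a
    convert h using 1
    funext p
    rw [Finset.sup'_apply]
    rfl

theorem measurable_sampQ (r : ℕ) (n : ℕ) (hn : 0 < n) (s : Fin n → S) (a : MacroAction S κ) :
    Measurable fun p : (Fin n → ℝ) × Seed S κ N => P.sampQ r ⟨n, hn, s, p.1⟩ a p.2 :=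
  P.measurable_sampQ_of_sampV (P.measurable_sampV r) n hn s a

theorem measurable_sampQ_seed (r : ℕ) (d : History S) (a : MacroAction S κ) :
    Measurable fun ω : Seed S κ N => P.sampQ r d a ω := by
  obtain ⟨n, hn, s, y⟩ := d
  have h : Measurable fun ω : Seed S κ N => (y, ω) := measurable_prodMk_left
  have h' := (P.measurable_sampQ (N := N) r n hn s a).comp h
  exact h'

theorem measurable_sampV_extend_sample (r : ℕ) (d : History S) (a : MacroAction S κ) :
    Measurable fun q : EuclideanSpace ℝ (Fin κ) × Seed S κ N =>
      P.sampV r (d.extend a (P.sample d a q.1)) q.2 := by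
  have h1 : Measurable fun q : EuclideanSpace ℝ (Fin κ) × Seed S κ N =>
      (Fin.append d.out fun i => P.sample d a q.1 i : Fin (d.len + κ) → ℝ) :=
    measurable_append.comp ((measurable_prodMk_left (x := d.out)).comp
      ((P.measurable_sample d a).comp measurable_fst))
  exact (P.measurable_sampV r (d.len + κ) (Nat.add_pos_left d.len_pos κ)
    (Fin.append d.loc a)).comp (h1.prodMk measurable_snd)

theorem lintegral_exp_div_le (hN : 0 < N) {s : ℝ} {M : ENNReal} {Ω : Type*} [MeasurableSpace Ω]
    {μ : Measure Ω} [IsProbabilityMeasure μ] {φ : Ω → ℝ} (hφ : Measurable φ)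
    (hM : ∫⁻ ω, ENNReal.ofReal (Real.exp (s * φ ω)) ∂μ ≤ M) :
    ∫⁻ ω, ENNReal.ofReal (Real.exp (s / N * φ ω)) ∂μ ≤ M ^ (N : ℝ)⁻¹ := by
  have hN' : (0 : ℝ) < N := by exact_mod_cast hN
  have h := lintegral_pow_le_lintegral_pow (μ := μ)
    (f := fun ω => ENNReal.ofReal (Real.exp (s / N * φ ω))) (by fun_prop) N
  have e : ∀ ω, ENNReal.ofReal (Real.exp (s / N * φ ω)) ^ N = ENNReal.ofReal (Real.exp (s * φ ω)) := by
    intro ω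
    rw [← ENNReal.ofReal_pow (Real.exp_pos _).le, ← Real.exp_nat_mul]
    congr 2
    field_simp
  simp_rw [e] at h
  rw [ENNReal.le_rpow_inv_iff hN', ENNReal.rpow_natCast]
  exact h.trans hM

/-- The integral factors over the `N` independent sub-seeds. One factor is at most `M ^ (1 / N) *
exp ((s / N) ^ 2 * K)` because `hM` is uniform in the sampled observation; the `N`-th power restores
`M` exactly, and only the fluctuation adds a factor. -/
theorem lintegral_exp_sum_subSeed_le (hN : 0 < N) (a : MacroAction S κ)
    {φ : EuclideanSpace ℝ (Fin κ) → Seed S κ N → ℝ} {m : EuclideanSpace ℝ (Fin κ) → ℝ}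
    (hφ : Measurable fun q : EuclideanSpace ℝ (Fin κ) × Seed S κ N => φ q.1 q.2)
    (hm : Measurable m) (hroot : ∀ x ω ω', (∀ p, p ≠ [] → ω p = ω' p) → φ x ω = φ x ω')
    {s K : ℝ} {M : ENNReal}
    (hM : ∀ x, ∫⁻ ω, ENNReal.ofReal (Real.exp (s * φ x ω)) ∂(seedMeasure S κ N) ≤ M)
    (hK : ∫⁻ x, ENNReal.ofReal (Real.exp (s / N * m x)) ∂(stdGaussian (EuclideanSpace ℝ (Fin κ)))
      ≤ ENNReal.ofReal (Real.exp ((s / N) ^ 2 * K))) :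
    ∫⁻ ω, ENNReal.ofReal (Real.exp (s / N * ∑ l, φ (ω [(a, l)]) (subSeed a l ω)
        + s / N * ∑ l, m (ω [(a, l)]))) ∂(seedMeasure S κ N)
      ≤ M * ENNReal.ofReal (Real.exp (s ^ 2 * K / N)) := by
  have hN' : (0 : ℝ) < N := by exact_mod_cast hN
  let G : EuclideanSpace ℝ (Fin κ) × Seed S κ N → ENNReal := fun q =>
    ENNReal.ofReal (Real.exp (s / N * φ q.1 q.2)) * ENNReal.ofReal (Real.exp (s / N * m q.1))
  have hG : Measurable G := by
    have h2 : Measurable fun q : EuclideanSpace ℝ (Fin κ) × Seed S κ N => m q.1 :=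
      hm.comp measurable_fst
    exact Measurable.mul (ENNReal.measurable_ofReal.comp (Real.measurable_exp.comp
      (hφ.const_mul (s / N)))) (ENNReal.measurable_ofReal.comp (Real.measurable_exp.comp
      (h2.const_mul (s / N))))
  have hpair : Measurable fun ω : Seed S κ N => (ω [], ω) :=
    (measurable_pi_apply []).prodMk measurable_id
  have hg : Measurable fun ω : Seed S κ N => G (ω [], ω) := by
    have h := hG.comp hpair
    exact h
  have h1 : ∫⁻ ω, G (ω [], ω) ∂(seedMeasure S κ N)
      ≤ M ^ (N : ℝ)⁻¹ * ENNReal.ofReal (Real.exp ((s / N) ^ 2 * K)) := by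
    rw [lintegral_root hG fun x ω ω' h => by simp only [G, hroot x ω ω' h]]
    calc _ ≤ ∫⁻ x, M ^ (N : ℝ)⁻¹ * ENNReal.ofReal (Real.exp (s / N * m x))
            ∂(stdGaussian (EuclideanSpace ℝ (Fin κ))) := by
          refine lintegral_mono fun x => ?_
          have hφx : Measurable (φ x) := hφ.comp measurable_prodMk_left
          simp only [G]
          rw [lintegral_mul_const _ (by fun_prop)]
          gcongr
          exact lintegral_exp_div_le hN hφx (hM _)
      _ ≤ _ := by
          rw [lintegral_const_mul _ (by fun_prop)]
          gcongr
  have hprod : ∀ ω : Seed S κ N, ENNReal.ofReal (Real.exp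
      (s / N * ∑ l, φ (ω [(a, l)]) (subSeed a l ω) + s / N * ∑ l, m (ω [(a, l)])))
        = ∏ l, G (subSeed a l ω [], subSeed a l ω) := by
    intro ω
    have e : ∀ l, G (subSeed a l ω [], subSeed a l ω) = ENNReal.ofReal (Real.exp
        (s / N * φ (ω [(a, l)]) (subSeed a l ω) + s / N * m (ω [(a, l)]))) := by
      intro l
      rw [Real.exp_add, ENNReal.ofReal_mul (Real.exp_pos _).le]
      rfl
    simp_rw [e]
    rw [← ENNReal.ofReal_prod_of_nonneg fun l _ => (Real.exp_pos _).le, ← Real.exp_sum,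
      Finset.sum_add_distrib, Finset.mul_sum, Finset.mul_sum]
  rw [lintegral_congr hprod, lintegral_prod_subSeed a hg]
  calc _ ≤ (M ^ (N : ℝ)⁻¹ * ENNReal.ofReal (Real.exp ((s / N) ^ 2 * K))) ^ N := by gcongr
    _ = _ := by
      rw [mul_pow, ← ENNReal.rpow_natCast, ← ENNReal.rpow_mul, inv_mul_cancel₀ hN'.ne',
        ENNReal.rpow_one, ← ENNReal.ofReal_pow (Real.exp_pos _).le, ← Real.exp_nat_mul]
      congr 3
      field_simp

theorem lintegral_exp_optV_sample_le (hκ : 1 ≤ κ) {Y : ℝ}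
    (hY : ∀ s, P.cov s s ≤ Y) (r : ℕ) {K : ℝ}
    (hK : (lipCoeff √(Y / P.noiseVar) r * κ ^ r) ^ 2 * κ * (Y + P.noiseVar) ≤ K)
    (d : History S) (a : MacroAction S κ) (τ : ℝ) :
    ∫⁻ x, ENNReal.ofReal (Real.exp (τ * (P.optV r (d.extend a (P.sample d a x))
        - ∫ z, P.optV r (d.extend a z) ∂(P.belief d a)))) ∂(stdGaussian (EuclideanSpace ℝ (Fin κ)))
      ≤ ENNReal.ofReal (Real.exp (τ ^ 2 * K)) := by
  have hlip := P.lipschitzInOut_optV hκ hY r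
  have hm := hlip.measurable_extend d a
  have h := lintegral_map (μ := stdGaussian (EuclideanSpace ℝ (Fin κ)))
    (f := fun z => ENNReal.ofReal (Real.exp (τ * (P.optV r (d.extend a z)
      - ∫ z, P.optV r (d.extend a z) ∂(P.belief d a))))) (by fun_prop) (P.measurable_sample d a)
  rw [← h, P.map_sample]
  refine (lintegral_exp_lipschitz_sub_integral_le (by lia) (P.postCov_posSemidef d a)
    (P.postCov_diag_le d a hY) hm (hlip.abs_extend_sub_le d a)
    (hlip.integrable_extend P d d a) τ).trans ?_
  apply ENNReal.ofReal_le_ofReal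
  apply Real.exp_le_exp.2
  have := mul_le_mul_of_nonneg_left hK (sq_nonneg τ)
  linarith

theorem abs_sampQ_sub_optQ_le (hN : 0 < N) (r : ℕ) (d : History S) (a : MacroAction S κ)
    (ω : Seed S κ N) :
    |P.sampQ r d a ω - P.optQ r d a| ≤ 1 / N *
      ∑ l, |P.sampV r (d.extend a (P.sample d a (ω [(a, l)]))) (subSeed a l ω)
        - P.optV r (d.extend a (P.sample d a (ω [(a, l)])))|
      + 1 / N * |∑ l, (P.optV r (d.extend a (P.sample d a (ω [(a, l)])))
        - ∫ z, P.optV r (d.extend a z) ∂(P.belief d a))| := by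
  have hN' : (0 : ℝ) < N := by exact_mod_cast hN
  set E := ∫ z, P.optV r (d.extend a z) ∂(P.belief d a) with hE
  have hdiff : P.sampQ r d a ω - P.optQ r d a = (1 / (N : ℝ)) *
      (∑ l, (P.sampV r (d.extend a (P.sample d a (ω [(a, l)]))) (subSeed a l ω)
        - P.optV r (d.extend a (P.sample d a (ω [(a, l)]))))
        + ∑ l, (P.optV r (d.extend a (P.sample d a (ω [(a, l)]))) - E)) := by
    rw [sampQ, optQ, add_sub_add_left_eq_sub, ← Finset.sum_add_distrib]
    have : E = 1 / (N : ℝ) * ∑ _l : Fin N, E := by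
      simp [hN'.ne']
    rw [← hE]
    conv_lhs => rw [this]
    rw [← mul_sub, ← Finset.sum_sub_distrib]
    congr 1
    refine Finset.sum_congr rfl fun l _ => ?_
    rw [sub_add_sub_cancel]
    rfl
  rw [hdiff, abs_mul, abs_of_nonneg (by positivity : (0 : ℝ) ≤ 1 / N), ← mul_add]
  gcongr
  refine (abs_add_le _ _).trans ?_
  gcongr
  exact Finset.abs_sum_le_sum_abs _ _

/-- The exponential of `|x|` is at most that of `x` plus that of `-x`, so the previous estimate is
used for `m` and `-m`; hence the factor 2. -/
theorem lintegral_exp_abs_sampQ_sub_optQ_le (hκ : 1 ≤ κ) (hN : 0 < N) {Y : ℝ}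
    (hY : ∀ s, P.cov s s ≤ Y) (r : ℕ) {K : ℝ}
    (hK : (lipCoeff √(Y / P.noiseVar) r * κ ^ r) ^ 2 * κ * (Y + P.noiseVar) ≤ K) {s : ℝ}
    (hs : 0 ≤ s) {M : ENNReal}
    (hM : ∀ d : History S, ∫⁻ ω, ENNReal.ofReal (Real.exp (s * |P.sampV r d ω - P.optV r d|))
      ∂(seedMeasure S κ N) ≤ M) (d : History S) (a : MacroAction S κ) :
    ∫⁻ ω, ENNReal.ofReal (Real.exp (s * |P.sampQ r d a ω - P.optQ r d a|)) ∂(seedMeasure S κ N)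
      ≤ 2 * M * ENNReal.ofReal (Real.exp (s ^ 2 * K / N)) := by
  have hN' : (0 : ℝ) < N := by exact_mod_cast hN
  have hlip := P.lipschitzInOut_optV hκ hY r
  obtain ⟨φ, hφ⟩ : ∃ φ : EuclideanSpace ℝ (Fin κ) → Seed S κ N → ℝ, φ = fun x ω =>
    |P.sampV r (d.extend a (P.sample d a x)) ω - P.optV r (d.extend a (P.sample d a x))| := ⟨_, rfl⟩
  obtain ⟨m, hm⟩ : ∃ m : EuclideanSpace ℝ (Fin κ) → ℝ, m = fun x =>
    P.optV r (d.extend a (P.sample d a x)) - ∫ z, P.optV r (d.extend a z) ∂(P.belief d a) :=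
    ⟨_, rfl⟩
  have hVm : Measurable fun x => P.optV r (d.extend a (P.sample d a x)) :=
    (hlip.measurable_extend d a).comp (P.measurable_sample d a)
  have hmm : Measurable m := by
    rw [hm]
    exact hVm.sub_const _
  have hφm : Measurable fun q : EuclideanSpace ℝ (Fin κ) × Seed S κ N => φ q.1 q.2 := by
    have h1 := P.measurable_sampV_extend_sample (N := N) r d a
    rw [hφ]
    exact Measurable.abs (Measurable.sub h1 (hVm.comp measurable_fst))
  have hroot : ∀ x ω ω', (∀ p, p ≠ [] → ω p = ω' p) → φ x ω = φ x ω' := by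
    intro x ω ω' h
    rw [hφ]
    simp only [P.sampV_congr_of_ne_nil r _ h]
  have hφM : ∀ x, ∫⁻ ω, ENNReal.ofReal (Real.exp (s * φ x ω)) ∂(seedMeasure S κ N) ≤ M := by
    intro x
    rw [hφ]
    exact hM _
  have hmK : ∀ τ : ℝ, ∫⁻ x, ENNReal.ofReal (Real.exp (τ * m x))
      ∂(stdGaussian (EuclideanSpace ℝ (Fin κ))) ≤ ENNReal.ofReal (Real.exp (τ ^ 2 * K)) := by
    intro τ
    rw [hm]
    exact P.lintegral_exp_optV_sample_le hκ hY r hK d a τ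
  have hpos := lintegral_exp_sum_subSeed_le hN a hφm hmm hroot hφM (hmK (s / N))
  have hneg := lintegral_exp_sum_subSeed_le (m := fun x => -m x) hN a hφm hmm.neg hroot hφM
    (s := s) (K := K) (by simpa only [neg_sq, neg_mul, mul_neg] using hmK (-(s / N)))
  have hpt : ∀ ω : Seed S κ N, ENNReal.ofReal (Real.exp (s * |P.sampQ r d a ω - P.optQ r d a|))
      ≤ ENNReal.ofReal (Real.exp (s / N * ∑ l, φ (ω [(a, l)]) (subSeed a l ω)
          + s / N * ∑ l, m (ω [(a, l)])))
        + ENNReal.ofReal (Real.exp (s / N * ∑ l, φ (ω [(a, l)]) (subSeed a l ω)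
          + s / N * ∑ l, -m (ω [(a, l)]))) := by
    intro ω
    have hX := mul_le_mul_of_nonneg_left (P.abs_sampQ_sub_optQ_le hN r d a ω) hs
    have hX' : s * |P.sampQ r d a ω - P.optQ r d a| ≤ s / N * ∑ l, φ (ω [(a, l)]) (subSeed a l ω)
        + s / N * |∑ l, m (ω [(a, l)])| := by
      refine hX.trans_eq ?_
      rw [mul_add, ← mul_assoc, ← mul_assoc, mul_one_div, hφ, hm]
    rw [← ENNReal.ofReal_add (Real.exp_pos _).le (Real.exp_pos _).le]
    apply ENNReal.ofReal_le_ofReal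
    refine (Real.exp_le_exp.2 hX').trans ?_
    rw [Finset.sum_neg_distrib]
    rcases abs_choice (∑ l, m (ω [(a, l)])) with h | h
    · rw [h]
      exact le_add_of_nonneg_right (Real.exp_pos _).le
    · rw [h]
      exact le_add_of_nonneg_left (Real.exp_pos _).le
  have hmeas : Measurable fun ω : Seed S κ N => ENNReal.ofReal (Real.exp
      (s / N * ∑ l, φ (ω [(a, l)]) (subSeed a l ω) + s / N * ∑ l, m (ω [(a, l)]))) := by
    have h0 : ∀ l : Fin N, Measurable fun ω : Seed S κ N => ω [(a, l)] :=
      fun l => measurable_pi_apply [(a, l)]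
    have h1 : ∀ l : Fin N, Measurable fun ω : Seed S κ N => φ (ω [(a, l)]) (subSeed a l ω) := by
      intro l
      have h := hφm.comp ((h0 l).prodMk (measurable_subSeed a l))
      exact h
    have h2 : ∀ l : Fin N, Measurable fun ω : Seed S κ N => m (ω [(a, l)]) :=
      fun l => hmm.comp (h0 l)
    exact ENNReal.measurable_ofReal.comp (Real.measurable_exp.comp
      (((Finset.measurable_fun_sum _ fun l _ => h1 l).const_mul _).add
        ((Finset.measurable_fun_sum _ fun l _ => h2 l).const_mul _)))
  refine (lintegral_mono hpt).trans ?_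
  rw [lintegral_add_left hmeas, mul_assoc, two_mul]
  exact add_le_add hpos hneg

/-- A difference of maxima is at most the largest difference, whose exponential is at most the sum
over the macro-actions. Each level thus multiplies the moment by `2 * A` and the fluctuation factor,
however many nodes the level has. -/
theorem lintegral_exp_abs_sampV_sub_optV_le (hκ : 1 ≤ κ) (hN : 0 < N) {Y : ℝ}
    (hY : ∀ s, P.cov s s ≤ Y) {A : ℕ} (hA : ∀ s, (P.actions s).card ≤ A) (r : ℕ) {K : ℝ}
    (hK : ∀ j < r, (lipCoeff √(Y / P.noiseVar) j * κ ^ j) ^ 2 * κ * (Y + P.noiseVar) ≤ K) {s : ℝ}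
    (hs : 0 ≤ s) (d : History S) :
    ∫⁻ ω, ENNReal.ofReal (Real.exp (s * |P.sampV r d ω - P.optV r d|)) ∂(seedMeasure S κ N)
      ≤ (A * (2 * ENNReal.ofReal (Real.exp (s ^ 2 * K / N)))) ^ r := by
  induction r generalizing d with
  | zero => simp [sampV, optV]
  | succ r ih =>
    set M := ((A : ENNReal) * (2 * ENNReal.ofReal (Real.exp (s ^ 2 * K / N)))) ^ r with hM
    have hQ := P.lintegral_exp_abs_sampQ_sub_optQ_le hκ hN hY r (hK r (by lia)) hs (M := M)
      (fun d => ih (fun j hj => hK j (by lia)) d)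
    have hpt : ∀ ω : Seed S κ N,
        ENNReal.ofReal (Real.exp (s * |P.sampV (r + 1) d ω - P.optV (r + 1) d|))
        ≤ ∑ a ∈ P.actions d.current,
          ENNReal.ofReal (Real.exp (s * |P.sampQ r d a ω - P.optQ r d a|)) := by
      intro ω
      obtain ⟨b, hb, hmax⟩ := Finset.exists_mem_eq_sup' (P.actions_nonempty d.current)
        fun a => |P.sampQ r d a ω - P.optQ r d a|
      have hle : |P.sampV (r + 1) d ω - P.optV (r + 1) d| ≤ |P.sampQ r d b ω - P.optQ r d b| := by
        rw [sampV_succ, optV_succ]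
        refine Finset.abs_sup'_sub_sup'_le _ fun a ha => ?_
        rw [← hmax]
        exact Finset.le_sup' (fun a => |P.sampQ r d a ω - P.optQ r d a|) ha
      refine le_trans ?_ (Finset.single_le_sum
        (f := fun a => ENNReal.ofReal (Real.exp (s * |P.sampQ r d a ω - P.optQ r d a|)))
        (fun _ _ => zero_le) hb)
      apply ENNReal.ofReal_le_ofReal
      apply Real.exp_le_exp.2
      gcongr
    refine (lintegral_mono hpt).trans ?_
    rw [lintegral_finsetSum _ fun a _ => by
      have := P.measurable_sampQ_seed (N := N) r d a
      fun_prop]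
    refine (Finset.sum_le_sum fun a _ => hQ d a).trans ?_
    rw [Finset.sum_const, nsmul_eq_mul]
    calc _ ≤ (A : ENNReal) * (2 * M * ENNReal.ofReal (Real.exp (s ^ 2 * K / N))) := by
          gcongr
          exact_mod_cast hA _
      _ = _ := by rw [pow_succ _ r, ← hM]; ring

/-- Markov's inequality for the exponential moment, with a union bound over the macro-actions at the
root only. -/
theorem seedMeasure_exists_lt_abs_le (hκ : 1 ≤ κ) (hN : 0 < N) {Y : ℝ}
    (hY : ∀ s, P.cov s s ≤ Y) {A : ℕ} (hA : ∀ s, (P.actions s).card ≤ A) (r : ℕ) {K : ℝ}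
    (hK : ∀ j ≤ r, (lipCoeff √(Y / P.noiseVar) j * κ ^ j) ^ 2 * κ * (Y + P.noiseVar) ≤ K) {s : ℝ}
    (hs : 0 ≤ s) (d : History S) (b : ℝ) :
    seedMeasure S κ N {ω | ∃ a ∈ P.actions d.current, b < |P.sampQ r d a ω - P.optQ r d a|}
      ≤ (A * (2 * ENNReal.ofReal (Real.exp (s ^ 2 * K / N)))) ^ (r + 1)
        * ENNReal.ofReal (Real.exp (-(s * b))) := by
  set M := ((A : ENNReal) * (2 * ENNReal.ofReal (Real.exp (s ^ 2 * K / N)))) ^ r with hM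
  have hQ := P.lintegral_exp_abs_sampQ_sub_optQ_le hκ hN hY r (hK r le_rfl) hs (M := M)
    (P.lintegral_exp_abs_sampV_sub_optV_le hκ hN hY hA r (fun j hj => hK j hj.le) hs) d
  have hone : ∀ a, seedMeasure S κ N {ω | b < |P.sampQ r d a ω - P.optQ r d a|}
      ≤ 2 * M * ENNReal.ofReal (Real.exp (s ^ 2 * K / N)) * ENNReal.ofReal (Real.exp (-(s * b))) := by
    intro a
    have h1 := mul_meas_ge_le_lintegral (μ := seedMeasure S κ N)
      (f := fun ω => ENNReal.ofReal (Real.exp (s * |P.sampQ r d a ω - P.optQ r d a|))) (by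
        have := P.measurable_sampQ_seed (N := N) r d a
        fun_prop) (ENNReal.ofReal (Real.exp (s * b)))
    have h2 : seedMeasure S κ N {ω | b < |P.sampQ r d a ω - P.optQ r d a|}
        ≤ seedMeasure S κ N {ω | ENNReal.ofReal (Real.exp (s * b))
          ≤ ENNReal.ofReal (Real.exp (s * |P.sampQ r d a ω - P.optQ r d a|))} := by
      refine measure_mono fun ω hω => ?_
      have hω' : b < |P.sampQ r d a ω - P.optQ r d a| := hω
      refine ENNReal.ofReal_le_ofReal (Real.exp_le_exp.2 ?_)
      gcongr
    calc _ ≤ ENNReal.ofReal (Real.exp (-(s * b))) * (ENNReal.ofReal (Real.exp (s * b))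
          * seedMeasure S κ N {ω | ENNReal.ofReal (Real.exp (s * b))
          ≤ ENNReal.ofReal (Real.exp (s * |P.sampQ r d a ω - P.optQ r d a|))}) := by
          rw [← mul_assoc, ← ENNReal.ofReal_mul (Real.exp_pos _).le, ← Real.exp_add,
            neg_add_cancel, Real.exp_zero, ENNReal.ofReal_one, one_mul]
          exact h2
      _ ≤ _ := by
          rw [mul_comm _ (ENNReal.ofReal (Real.exp (-(s * b))))]
          exact mul_le_mul_right (h1.trans (hQ a)) _
  have hset : {ω : Seed S κ N | ∃ a ∈ P.actions d.current, b < |P.sampQ r d a ω - P.optQ r d a|}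
      = ⋃ a ∈ P.actions d.current, {ω | b < |P.sampQ r d a ω - P.optQ r d a|} := by
    ext ω; simp
  rw [hset]
  refine (measure_biUnion_finset_le _ _).trans ((Finset.sum_le_sum fun a _ => hone a).trans ?_)
  rw [Finset.sum_const, nsmul_eq_mul]
  calc _ ≤ (A : ENNReal) * (2 * M * ENNReal.ofReal (Real.exp (s ^ 2 * K / N))
          * ENNReal.ofReal (Real.exp (-(s * b)))) := by
        gcongr
        exact_mod_cast hA _
    _ = _ := by rw [pow_succ _ r, ← hM]; ring

end MacroGPO

/-! ### Measurability and integrability of policy values; optimality of `optV`. -/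

-- The set of maximizers takes finitely many values, each on an event given by comparisons, and
-- `tie` sees only this set; no regularity of `tie` is required.
open Classical in
theorem measurableSet_tie_filter_max_eq {X α : Type*} [MeasurableSpace X] (s : Finset α)
    {q : α → X → ℝ} (hq : ∀ a ∈ s, Measurable (q a)) (tie : Finset α → α) (a : α) :
    MeasurableSet {x | tie (s.filter fun a => ∀ b ∈ s, q b x ≤ q a x) = a} := by
  have hmem : ∀ c ∈ s, MeasurableSet {x | ∀ b ∈ s, q b x ≤ q c x} := by
    intro c hc
    have : {x | ∀ b ∈ s, q b x ≤ q c x} = ⋂ b ∈ s, {x | q b x ≤ q c x} := by ext; simp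
    rw [this]
    exact Finset.measurableSet_biInter _ fun b hb => measurableSet_le (hq b hb) (hq c hc)
  have heq : ∀ M ∈ s.powerset,
      MeasurableSet {x | (s.filter fun a => ∀ b ∈ s, q b x ≤ q a x) = M} := by
    intro M hM
    have : {x | (s.filter fun a => ∀ b ∈ s, q b x ≤ q a x) = M}
        = ⋂ c ∈ s, {x | (∀ b ∈ s, q b x ≤ q c x) ↔ c ∈ M} := by
      ext x
      simp only [Set.mem_ofPred_eq, Set.mem_iInter, Finset.ext_iff, Finset.mem_filter]
      refine forall_congr' fun c => ?_
      have : c ∈ M → c ∈ s := fun h => Finset.mem_powerset.1 hM h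
      tauto
    rw [this]
    refine Finset.measurableSet_biInter _ fun c hc => ?_
    by_cases h : c ∈ M
    · simpa only [h, iff_true] using hmem c hc
    · have e : {x | (∀ b ∈ s, q b x ≤ q c x) ↔ c ∈ M} = {x | ∀ b ∈ s, q b x ≤ q c x}ᶜ := by
        ext x; simp [h]
      rw [e]
      exact (hmem c hc).compl
  have : {x | tie (s.filter fun a => ∀ b ∈ s, q b x ≤ q a x) = a}
      = ⋃ M ∈ s.powerset.filter fun M => tie M = a,
        {x | (s.filter fun a => ∀ b ∈ s, q b x ≤ q a x) = M} := by
    ext x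
    simp only [Set.mem_ofPred_eq, Set.mem_iUnion, Finset.mem_filter, Finset.mem_powerset]
    constructor
    · intro h
      exact ⟨_, ⟨Finset.filter_subset _ _, h⟩, rfl⟩
    · rintro ⟨M, ⟨_, h⟩, rfl⟩
      exact h
  rw [this]
  exact Finset.measurableSet_biUnion _ fun M hM => heq M (Finset.mem_filter.1 hM).1

open Classical in
theorem filter_max_nonempty {α : Type*} {s : Finset α} (hs : s.Nonempty) (q : α → ℝ) :
    (s.filter fun a => ∀ b ∈ s, q b ≤ q a).Nonempty := by
  obtain ⟨a, ha, h⟩ := s.exists_max_image q hs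
  exact ⟨a, Finset.mem_filter.2 ⟨ha, h⟩⟩

namespace MacroGPO

variable {S : Type u} {κ : ℕ} (P : MacroGPO S κ) {Ω : Type*} [MeasurableSpace Ω]

/-- A random function of the data that depends measurably on the measurements and the randomness. -/
def MeasurableInOut (F : Ω → History S → ℝ) : Prop :=
  ∀ (n : ℕ) (hn : 0 < n) (s : Fin n → S),
    Measurable fun p : (Fin n → ℝ) × Ω => F p.2 ⟨n, hn, s, p.1⟩

namespace MeasurableInOut

variable {F : Ω → History S → ℝ}

theorem extend_sample (hF : MeasurableInOut F) {n : ℕ} (hn : 0 < n) (s : Fin n → S)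
    (a : MacroAction S κ) :
    Measurable fun q : ((Fin n → ℝ) × Ω) × EuclideanSpace ℝ (Fin κ) =>
      F q.1.2 (History.extend ⟨n, hn, s, q.1.1⟩ a (P.sample ⟨n, hn, s, q.1.1⟩ a q.2)) := by
  have h : Measurable fun q : ((Fin n → ℝ) × Ω) × EuclideanSpace ℝ (Fin κ) => (q.1.1, q.2) := by
    fun_prop
  have h0 := (P.continuous_sample hn s a).measurable.comp h
  have h00 := Measurable.prodMk
    (show Measurable fun q : ((Fin n → ℝ) × Ω) × EuclideanSpace ℝ (Fin κ) => q.1.1 by fun_prop) h0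
  have h1 := Measurable.prodMk (measurable_append.comp h00)
    (show Measurable fun q : ((Fin n → ℝ) × Ω) × EuclideanSpace ℝ (Fin κ) => q.1.2 by fun_prop)
  have h2 := (hF (n + κ) (Nat.add_pos_left hn κ) (Fin.append s a)).comp h1
  exact h2

theorem extend (hF : MeasurableInOut F) (d : History S) (a : MacroAction S κ) :
    Measurable fun q : EuclideanSpace ℝ (Fin κ) × Ω => F q.2 (d.extend a q.1) := by
  have h1 : Measurable fun q : EuclideanSpace ℝ (Fin κ) × Ω =>
      ((Fin.append d.out fun i => q.1 i : Fin (d.len + κ) → ℝ), q.2) :=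
    (measurable_append.comp ((measurable_prodMk_left (x := d.out)).comp measurable_fst)).prodMk
      measurable_snd
  have h2 := (hF (d.len + κ) (Nat.add_pos_left d.len_pos κ) (Fin.append d.loc a)).comp h1
  exact h2

theorem extend_left (hF : MeasurableInOut F) (ω : Ω) (d : History S) (a : MacroAction S κ) :
    Measurable fun z : EuclideanSpace ℝ (Fin κ) => F ω (d.extend a z) :=
  (hF.extend d a).comp measurable_prodMk_right

/-- The belief varies with the measurements; written through `sample`, the integral is over a fixed
Gaussian measure and joint measurability applies. -/
theorem integral_extend (hF : MeasurableInOut F) (a : MacroAction S κ) :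
    MeasurableInOut fun ω d => ∫ z, F ω (d.extend a z) ∂(P.belief d a) := by
  intro n hn s
  have h := (hF.extend_sample P hn s a).stronglyMeasurable.integral_prod_right'
    (ν := stdGaussian (EuclideanSpace ℝ (Fin κ)))
  convert h.measurable using 2 with p
  exact P.integral_belief (hF.extend_left p.2 _ a) _ a

theorem reward_add_integral_extend (hF : MeasurableInOut F) (a : MacroAction S κ) :
    MeasurableInOut fun ω d => P.reward d a + ∫ z, F ω (d.extend a z) ∂(P.belief d a) :=
  fun n hn s => ((P.continuous_reward hn s a).measurable.comp measurable_fst).add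
    (hF.integral_extend P a n hn s)

end MeasurableInOut

/-- A random policy that depends measurably on the measurements and the randomness. -/
structure IsRandomPolicy (π : Ω → ℕ → History S → MacroAction S κ) : Prop where
  mem_actions : ∀ ω t d, π ω t d ∈ P.actions d.current
  measurable : ∀ (t n : ℕ) (hn : 0 < n) (s : Fin n → S) (a : MacroAction S κ),
    MeasurableSet {p : (Fin n → ℝ) × Ω | π p.2 t ⟨n, hn, s, p.1⟩ = a}

namespace IsRandomPolicy

variable {P} {π : Ω → ℕ → History S → MacroAction S κ}

theorem isPolicy (hπ : P.IsRandomPolicy π) (ω : Ω) : P.IsPolicy (π ω) where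
  mem_actions := hπ.mem_actions ω
  measurable t n hn s a := measurable_prodMk_right (y := ω) (hπ.measurable t n hn s a)

theorem measurableSet_eq (hπ : P.IsRandomPolicy π) (t : ℕ) (d : History S) (a : MacroAction S κ) :
    MeasurableSet {ω | π ω t d = a} :=
  measurable_prodMk_left (x := d.out) (hπ.measurable t d.len d.len_pos d.loc a)

theorem measurable_policyValue (hπ : P.IsRandomPolicy π) (r t : ℕ) :
    MeasurableInOut fun ω d => P.policyValue (π ω) r t d := by
  classical
  induction r generalizing t with
  | zero => intro n hn s; exact measurable_const
  | succ r ih =>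
    intro n hn s
    have hG : ∀ a, Measurable fun p : (Fin n → ℝ) × Ω =>
        P.reward ⟨n, hn, s, p.1⟩ a + ∫ z, P.policyValue (π p.2) r (t + 1)
          (History.extend ⟨n, hn, s, p.1⟩ a z) ∂(P.belief ⟨n, hn, s, p.1⟩ a) := fun a =>
      (ih (t + 1)).reward_add_integral_extend P a n hn s
    -- Exactly one of the finitely many available macro-actions is chosen, so the value is a finite
    -- sum of indicators.
    have h := Finset.measurable_fun_sum (P.actions (s ⟨n - 1, by lia⟩)) fun a _ =>
      (hG a).indicator (hπ.measurable t n hn s a)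
    convert h using 2 with p
    have hmem : π p.2 t ⟨n, hn, s, p.1⟩ ∈ P.actions (s ⟨n - 1, by lia⟩) := hπ.mem_actions _ _ _
    refine Eq.trans ?_ (Finset.sum_eq_single_of_mem _ hmem fun b _ hb => ?_).symm
    · rw [Set.indicator_of_mem (by simp)]
      rfl
    · have hb' : p ∉ {p : (Fin n → ℝ) × Ω | π p.2 t ⟨n, hn, s, p.1⟩ = b} := fun h => hb h.symm
      exact Set.indicator_of_notMem hb' _

end IsRandomPolicy

theorem IsPolicy.isRandomPolicy {P : MacroGPO S κ} {π : ℕ → History S → MacroAction S κ}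
    (hπ : P.IsPolicy π) : P.IsRandomPolicy fun _ : Unit => π where
  mem_actions _ := hπ.mem_actions
  measurable t n hn s a := measurable_fst (hπ.measurable t n hn s a)

theorem IsPolicy.measurable_policyValue {P : MacroGPO S κ} {π : ℕ → History S → MacroAction S κ}
    (hπ : P.IsPolicy π) (r t : ℕ) (d : History S) (a : MacroAction S κ) :
    Measurable fun z => P.policyValue π r t (d.extend a z) :=
  (hπ.isRandomPolicy.measurable_policyValue r t).extend_left () d a

theorem norm_toLp_extend_le {n : ℕ} (y : Fin n → ℝ) (z : EuclideanSpace ℝ (Fin κ)) :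
    ‖(WithLp.toLp 2 (Fin.append y fun i => z i) : EuclideanSpace ℝ (Fin (n + κ)))‖
      ≤ ‖(WithLp.toLp 2 y : EuclideanSpace ℝ (Fin n))‖ + ‖z‖ := by
  have h := norm_toLp_append_sub_le y 0 (fun i => z i) 0
  have e : (Fin.append 0 0 : Fin (n + κ) → ℝ) = 0 := by
    ext i
    refine Fin.addCases (fun i => ?_) (fun i => ?_) i <;> simp
  simpa only [e, sub_zero] using h

theorem integral_norm_belief_le (hκ : 1 ≤ κ) {Y : ℝ} (hY : ∀ s, P.cov s s ≤ Y) {n : ℕ}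
    (hn : 0 < n) (s : Fin n → S) (y : Fin n → ℝ) (a : MacroAction S κ) :
    ∫ z, ‖z‖ ∂(P.belief ⟨n, hn, s, y⟩ a) ≤ ∫ z, ‖z‖ ∂(P.belief ⟨n, hn, s, 0⟩ a)
      + κ * (√(Y / P.noiseVar) * ‖(WithLp.toLp 2 y : EuclideanSpace ℝ (Fin n))‖) := by
  have hi : ∀ y, Integrable (fun x => ‖P.sample ⟨n, hn, s, y⟩ a x‖)
      (stdGaussian (EuclideanSpace ℝ (Fin κ))) := fun y =>
    (P.integrable_belief_iff measurable_norm _ _).1 IsGaussian.integrable_id.norm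
  rw [P.integral_belief measurable_norm, P.integral_belief measurable_norm]
  set b := κ * (√(Y / P.noiseVar) * ‖(WithLp.toLp 2 y : EuclideanSpace ℝ (Fin n))‖)
  have e : ∫ x, ‖P.sample ⟨n, hn, s, 0⟩ a x‖ ∂(stdGaussian (EuclideanSpace ℝ (Fin κ))) + b
      = ∫ x, (‖P.sample ⟨n, hn, s, 0⟩ a x‖ + b) ∂(stdGaussian (EuclideanSpace ℝ (Fin κ))) := by
    rw [integral_add (hi 0) (integrable_const _)]; simp
  rw [e]
  refine integral_mono (hi y) ((hi 0).add (integrable_const _)) fun x => ?_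
  have h1 := P.sample_sub_sample hn s y 0 a x
  have h2 : ‖P.postMean ⟨n, hn, s, y⟩ a - P.postMean ⟨n, hn, s, 0⟩ a‖ ≤ b := by
    have := norm_toLp_le_mul hκ (fun i => (P.postMean ⟨n, hn, s, y⟩ a
      - P.postMean ⟨n, hn, s, 0⟩ a) i) fun i => P.abs_postMean_sub_le hn s y 0 a hY i
    simpa only [sub_zero] using this
  have h3 := norm_le_norm_add_norm_sub' (P.sample ⟨n, hn, s, y⟩ a x) (P.sample ⟨n, hn, s, 0⟩ a x)
  rw [h1] at h3
  simp only
  linarith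

/-- Linear growth in the measurements, uniform over policies and stages, supplies the integrable
majorant for exchanging expectations over observations and seeds. Finiteness of the action sets lets
one constant serve all choices. -/
theorem exists_policyValue_growth (hκ : 1 ≤ κ) {Y : ℝ} (hY : ∀ s, P.cov s s ≤ Y) (r : ℕ) {n : ℕ}
    (hn : 0 < n) (s : Fin n → S) :
    ∃ C : ℝ, 0 ≤ C ∧ ∀ (π : ℕ → History S → MacroAction S κ), P.IsPolicy π →
      ∀ (t : ℕ) (y : Fin n → ℝ), |P.policyValue π r t ⟨n, hn, s, y⟩|
        ≤ C * (1 + ‖(WithLp.toLp 2 y : EuclideanSpace ℝ (Fin n))‖) := by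
  induction r generalizing n with
  | zero => exact ⟨0, le_rfl, fun π _ t y => by simp [policyValue]⟩
  | succ r ih =>
    set L := √(Y / P.noiseVar) with hL
    have hL0 : 0 ≤ L := Real.sqrt_nonneg _
    choose C hC0 hC using fun a : MacroAction S κ =>
      ih (n := n + κ) (Nat.add_pos_left hn κ) (Fin.append s a)
    set m : MacroAction S κ → ℝ := fun a => ∫ z, ‖z‖ ∂(P.belief ⟨n, hn, s, 0⟩ a)
    have hm : ∀ a, 0 ≤ m a := fun a => integral_nonneg fun z => norm_nonneg _
    set B : MacroAction S κ → ℝ := fun a => |P.reward ⟨n, hn, s, 0⟩ a| + κ * L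
      + C a * (1 + m a + κ * L)
    have hB : ∀ a, 0 ≤ B a := fun a => by
      have := hm a
      have := hC0 a
      positivity
    refine ⟨∑ a ∈ P.actions (s ⟨n - 1, by lia⟩), B a, Finset.sum_nonneg fun a _ => hB a,
      fun π hπ t y => ?_⟩
    obtain ⟨a, ha⟩ : ∃ a, π t ⟨n, hn, s, y⟩ = a := ⟨_, rfl⟩
    have hmem : a ∈ P.actions (s ⟨n - 1, by lia⟩) := ha ▸ hπ.mem_actions t ⟨n, hn, s, y⟩
    set w := ‖(WithLp.toLp 2 y : EuclideanSpace ℝ (Fin n))‖ with hw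
    have hw0 : 0 ≤ w := norm_nonneg _
    have hle : B a ≤ ∑ a ∈ P.actions (s ⟨n - 1, by lia⟩), B a :=
      Finset.single_le_sum (fun a _ => hB a) hmem
    refine le_trans ?_ (mul_le_mul_of_nonneg_right hle (by positivity))
    have hr : |P.reward ⟨n, hn, s, y⟩ a| ≤ |P.reward ⟨n, hn, s, 0⟩ a| + κ * (L * w) := by
      have h1 := P.abs_reward_sub_le hn s y 0 a hY
      rw [sub_zero] at h1
      have h2 := abs_sub_abs_le_abs_sub (P.reward ⟨n, hn, s, y⟩ a) (P.reward ⟨n, hn, s, 0⟩ a)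
      linarith
    have hi : Integrable (fun z => ‖z‖) (P.belief ⟨n, hn, s, y⟩ a) := IsGaussian.integrable_id.norm
    have hI : |∫ z, P.policyValue π r (t + 1) (History.extend ⟨n, hn, s, y⟩ a z)
        ∂(P.belief ⟨n, hn, s, y⟩ a)| ≤ C a * (1 + w + (m a + κ * (L * w))) := by
      rw [← Real.norm_eq_abs]
      refine (norm_integral_le_of_norm_le (g := fun z => C a * (1 + w + ‖z‖))
        (((integrable_const _).add hi).const_mul _) (ae_of_all _ fun z => ?_)).trans ?_
      · rw [Real.norm_eq_abs]
        refine (hC a π hπ (t + 1) _).trans (mul_le_mul_of_nonneg_left ?_ (hC0 a))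
        have := norm_toLp_extend_le y z
        linarith
      · rw [integral_const_mul, integral_add (integrable_const _) hi]
        refine mul_le_mul_of_nonneg_left ?_ (hC0 a)
        have := P.integral_norm_belief_le hκ hY hn s y a
        simpa using this
    have hval : P.policyValue π (r + 1) t ⟨n, hn, s, y⟩ = P.reward ⟨n, hn, s, y⟩ a
        + ∫ z, P.policyValue π r (t + 1) (History.extend ⟨n, hn, s, y⟩ a z)
          ∂(P.belief ⟨n, hn, s, y⟩ a) := by
      rw [policyValue, ha]
    rw [hval]
    refine (abs_add_le _ _).trans ((add_le_add hr hI).trans ?_)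
    have h1 := hC0 a
    have h2 := hm a
    have e : B a * (1 + w) - (|P.reward ⟨n, hn, s, 0⟩ a| + κ * (L * w)
        + C a * (1 + w + (m a + κ * (L * w))))
        = |P.reward ⟨n, hn, s, 0⟩ a| * w + κ * L + C a * (m a * w + κ * L) := by
      simp only [B]; ring
    have : 0 ≤ |P.reward ⟨n, hn, s, 0⟩ a| * w + κ * L + C a * (m a * w + κ * L) := by positivity
    linarith

theorem exists_policyValue_extend_growth (hκ : 1 ≤ κ) {Y : ℝ} (hY : ∀ s, P.cov s s ≤ Y) (r : ℕ)
    (d : History S) (a : MacroAction S κ) :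
    ∃ C : ℝ, 0 ≤ C ∧ ∀ (π : ℕ → History S → MacroAction S κ), P.IsPolicy π →
      ∀ (t : ℕ) (z : EuclideanSpace ℝ (Fin κ)), |P.policyValue π r t (d.extend a z)|
        ≤ C * (1 + ‖(WithLp.toLp 2 d.out : EuclideanSpace ℝ (Fin d.len))‖ + ‖z‖) := by
  obtain ⟨C, hC0, hC⟩ := P.exists_policyValue_growth hκ hY r (Nat.add_pos_left d.len_pos κ)
    (Fin.append d.loc a)
  refine ⟨C, hC0, fun π hπ t z => (hC π hπ t _).trans (mul_le_mul_of_nonneg_left ?_ hC0)⟩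
  have := norm_toLp_extend_le d.out z
  linarith

theorem IsPolicy.integrable_policyValue {P : MacroGPO S κ} (hκ : 1 ≤ κ) {Y : ℝ}
    (hY : ∀ s, P.cov s s ≤ Y) {π : ℕ → History S → MacroAction S κ}
    (hπ : P.IsPolicy π) (r t : ℕ) (d : History S) (a : MacroAction S κ) :
    Integrable (fun z => P.policyValue π r t (d.extend a z)) (P.belief d a) := by
  obtain ⟨C, _, hC⟩ := P.exists_policyValue_extend_growth hκ hY r d a
  have hi : Integrable (fun z : EuclideanSpace ℝ (Fin κ) => C *
      (1 + ‖(WithLp.toLp 2 d.out : EuclideanSpace ℝ (Fin d.len))‖ + ‖z‖)) (P.belief d a) :=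
    ((integrable_const _).add IsGaussian.integrable_id.norm).const_mul _
  exact hi.mono' (hπ.measurable_policyValue r t d a).aestronglyMeasurable
    (ae_of_all _ fun z => hC π hπ t z)

theorem optQ_le_optV (r : ℕ) (d : History S) {a : MacroAction S κ} (ha : a ∈ P.actions d.current) :
    P.optQ r d a ≤ P.optV (r + 1) d :=
  Finset.le_sup' (fun a => P.optQ r d a) ha

theorem IsPolicy.policyValue_le_optV {P : MacroGPO S κ} (hκ : 1 ≤ κ) {Y : ℝ}
    (hY : ∀ s, P.cov s s ≤ Y) {π : ℕ → History S → MacroAction S κ} (hπ : P.IsPolicy π)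
    (r t : ℕ) (d : History S) : P.policyValue π r t d ≤ P.optV r d := by
  induction r generalizing t d with
  | zero => exact le_rfl
  | succ r ih =>
    refine le_trans ?_ (P.optQ_le_optV r d (hπ.mem_actions t d))
    rw [policyValue, optQ]
    exact add_le_add_right (integral_mono (hπ.integrable_policyValue hκ hY r (t + 1) d _)
      ((P.lipschitzInOut_optV hκ hY r).integrable_extend P d d _) fun z => ih (t + 1) _) _

theorem measurableInOut_optV (hκ : 1 ≤ κ) {Y : ℝ} (hY : ∀ s, P.cov s s ≤ Y) (r : ℕ) :
    MeasurableInOut fun (_ : Ω) d => P.optV r d :=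
  fun _ hn s => ((P.lipschitzInOut_optV hκ hY r).continuous hn s).measurable.comp measurable_fst

theorem measurableInOut_optQ (hκ : 1 ≤ κ) {Y : ℝ} (hY : ∀ s, P.cov s s ≤ Y) (r : ℕ)
    (a : MacroAction S κ) : MeasurableInOut fun (_ : Ω) d => P.optQ r d a :=
  (P.measurableInOut_optV hκ hY r).reward_add_integral_extend P a

-- A policy greedy for `optQ` attains equality at every stage of the recursion.
open Classical in
theorem exists_isPolicy_policyValue_eq_optV (hκ : 1 ≤ κ) {Y : ℝ} (hY : ∀ s, P.cov s s ≤ Y) (H : ℕ)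
    (d₀ : History S) : ∃ π, P.IsPolicy π ∧ P.policyValue π H 0 d₀ = P.optV H d₀ := by
  obtain ⟨a₀, -⟩ := P.actions_nonempty d₀.current
  -- The default `a₀` is never used, since sets of maximizers are nonempty.
  let tie : Finset (MacroAction S κ) → MacroAction S κ :=
    fun M => if h : M.Nonempty then h.choose else a₀
  have htie : ∀ M : Finset (MacroAction S κ), M.Nonempty → tie M ∈ M := by
    intro M h
    simp only [tie, dif_pos h]
    exact h.choose_spec
  let π : ℕ → History S → MacroAction S κ := fun t d =>
    tie ((P.actions d.current).filter fun a => ∀ b ∈ P.actions d.current,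
      P.optQ (H - (t + 1)) d b ≤ P.optQ (H - (t + 1)) d a)
  have hmem : ∀ t d, π t d ∈ (P.actions d.current).filter fun a => ∀ b ∈ P.actions d.current,
      P.optQ (H - (t + 1)) d b ≤ P.optQ (H - (t + 1)) d a := fun t d =>
    htie _ (filter_max_nonempty (P.actions_nonempty _) _)
  have hπ : P.IsPolicy π :=
    { mem_actions := fun t d => (Finset.mem_filter.1 (hmem t d)).1
      measurable := fun t n hn s a => by
        refine measurableSet_tie_filter_max_eq (P.actions (s ⟨n - 1, by lia⟩))
          (q := fun a (y : Fin n → ℝ) => P.optQ (H - (t + 1)) ⟨n, hn, s, y⟩ a) (fun b _ => ?_) tie a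
        have h0 : Measurable fun y : Fin n → ℝ => (y, ()) := measurable_prodMk_right
        have h := (P.measurableInOut_optQ (Ω := Unit) hκ hY (H - (t + 1)) b n hn s).comp h0
        exact h }
  have key : ∀ (r t : ℕ) (d : History S), r + t = H → P.policyValue π r t d = P.optV r d := by
    intro r
    induction r with
    | zero => intro t d _; rfl
    | succ r ih =>
      intro t d hrt
      have hr : H - (t + 1) = r := by lia
      have h1 : P.policyValue π (r + 1) t d = P.optQ r d (π t d) := by
        rw [policyValue, optQ]
        congr 2
        funext z
        exact ih (t + 1) _ (by lia)
      rw [h1]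
      refine le_antisymm (P.optQ_le_optV r d (hπ.mem_actions t d)) (Finset.sup'_le _ _ ?_)
      have := (Finset.mem_filter.1 (hmem t d)).2
      rw [hr] at this
      exact this
  exact ⟨π, hπ, key H 0 d₀ (by lia)⟩

theorem isGreatest_optV (hκ : 1 ≤ κ) {Y : ℝ} (hY : ∀ s, P.cov s s ≤ Y) (H : ℕ) (d₀ : History S) :
    IsGreatest {v | ∃ π, P.IsPolicy π ∧ v = P.policyValue π H 0 d₀} (P.optV H d₀) := by
  constructor
  · obtain ⟨π, hπ, h⟩ := P.exists_isPolicy_policyValue_eq_optV hκ hY H d₀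
    exact ⟨π, hπ, h.symm⟩
  · rintro v ⟨π, hπ, rfl⟩
    exact hπ.policyValue_le_optV hκ hY H 0 d₀

end MacroGPO

/-! ### Expected loss of policies with fresh randomness at every stage. -/

namespace MacroGPO

variable {S : Type u} {κ : ℕ} (P : MacroGPO S κ)

section ExpectedLoss

variable {P}

theorem policyValue_congr {π π' : ℕ → History S → MacroAction S κ} (r t : ℕ) (d : History S)
    (h : ∀ t', t ≤ t' → ∀ d, π t' d = π' t' d) :
    P.policyValue π r t d = P.policyValue π' r t d := by
  induction r generalizing t d with
  | zero => rfl
  | succ r ih =>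
    rw [policyValue, policyValue, h t le_rfl d]
    congr 2
    funext z
    exact ih (t + 1) _ fun t' ht' => h t' (by lia)

theorem IsRandomPolicy.integrable_policyValue {Ω : Type*} [MeasurableSpace Ω] {μ : Measure Ω}
    [IsProbabilityMeasure μ] (hκ : 1 ≤ κ) {Y : ℝ} (hY : ∀ s, P.cov s s ≤ Y)
    {π : Ω → ℕ → History S → MacroAction S κ} (hπ : P.IsRandomPolicy π) (r t : ℕ) (d : History S) :
    Integrable (fun ω => P.policyValue (π ω) r t d) μ := by
  obtain ⟨C, _, hC⟩ := P.exists_policyValue_growth hκ hY r d.len_pos d.loc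
  have hm := (hπ.measurable_policyValue r t d.len d.len_pos d.loc).comp
    (measurable_prodMk_left (x := d.out))
  exact Integrable.of_bound hm.aestronglyMeasurable
    (C * (1 + ‖(WithLp.toLp 2 d.out : EuclideanSpace ℝ (Fin d.len))‖))
    (ae_of_all _ fun ω => hC (π ω) (hπ.isPolicy ω) t d.out)

theorem IsRandomPolicy.integrable_policyValue_prod {Ω : Type*} [MeasurableSpace Ω] {μ : Measure Ω}
    [IsProbabilityMeasure μ] (hκ : 1 ≤ κ) {Y : ℝ} (hY : ∀ s, P.cov s s ≤ Y)
    {π : Ω → ℕ → History S → MacroAction S κ} (hπ : P.IsRandomPolicy π) (r t : ℕ) (d : History S)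
    (a : MacroAction S κ) :
    Integrable (fun q : EuclideanSpace ℝ (Fin κ) × Ω => P.policyValue (π q.2) r t (d.extend a q.1))
      ((P.belief d a).prod μ) := by
  obtain ⟨C, _, hC⟩ := P.exists_policyValue_extend_growth hκ hY r d a
  have hi : Integrable (fun z : EuclideanSpace ℝ (Fin κ) => C *
      (1 + ‖(WithLp.toLp 2 d.out : EuclideanSpace ℝ (Fin d.len))‖ + ‖z‖)) (P.belief d a) :=
    ((integrable_const _).add IsGaussian.integrable_id.norm).const_mul _
  exact (hi.comp_fst μ).mono' ((hπ.measurable_policyValue r t).extend d a).aestronglyMeasurable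
    (ae_of_all _ fun q => hC (π q.2) (hπ.isPolicy q.2) t q.1)

/-- If the expected loss of every single decision is at most `e`, then the expected loss of a policy
whose decisions use independent randomness at different stages is at most `e` per stage. -/
theorem IsRandomPolicy.optV_sub_integral_policyValue_le {X : Type*} [MeasurableSpace X]
    {ν : Measure X} [IsProbabilityMeasure ν] (hκ : 1 ≤ κ) {Y : ℝ} (hY : ∀ s, P.cov s s ≤ Y)
    {ρ : ℕ → History S → X → MacroAction S κ}
    (hπ : P.IsRandomPolicy fun (ω : ℕ → X) t d => ρ t d (ω t)) {H : ℕ} {e : ℝ}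
    (hloss : ∀ (r t : ℕ) (d : History S), r + 1 + t = H → ∃ ℓ : X → ℝ, Integrable ℓ ν ∧
      (∀ x, P.optV (r + 1) d - P.optQ r d (ρ t d x) ≤ ℓ x) ∧ ∫ x, ℓ x ∂ν ≤ e)
    (r t : ℕ) (d : History S) (hrt : r + t = H) :
    P.optV r d - ∫ ω, P.policyValue (fun t d => ρ t d (ω t)) r t d
      ∂(Measure.infinitePi fun _ : ℕ => ν) ≤ r * e := by
  induction r generalizing t d with
  | zero => simp [optV, policyValue]
  | succ r ih =>
    set μ := Measure.infinitePi fun _ : ℕ => ν with hμ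
    -- An integrable majorant `ℓ` spares proving that the loss itself is measurable in the seed.
    obtain ⟨ℓ, hℓi, hℓ, hℓe⟩ := hloss r t d hrt
    set F : (ℕ → X) → ℝ := fun ω => P.policyValue (fun t d => ρ t d (ω t)) (r + 1) t d with hF
    have hFi : Integrable F μ := hπ.integrable_policyValue hκ hY (r + 1) t d
    have hum := measurable_update_prod (X := X) t
    have hmap := Measure.map_update_infinitePi ν t
    rw [← hμ] at hmap
    have hFi' : Integrable (fun q : (ℕ → X) × X => F (Function.update q.1 t q.2)) (μ.prod ν) := by
      have h : Integrable F ((μ.prod ν).map fun q : (ℕ → X) × X => Function.update q.1 t q.2) := by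
        rw [hmap]; exact hFi
      exact h.comp_measurable hum
    -- The seed of stage `t` is resampled, so the current decision can be averaged separately from
    -- all later ones.
    have hFint : ∫ ω, F ω ∂μ = ∫ x, ∫ ω, F (Function.update ω t x) ∂μ ∂ν := by
      rw [← integral_prod_symm _ hFi']
      conv_lhs => rw [← hmap]
      rw [integral_map hum.aemeasurable]
      rw [hmap]
      exact hFi.aestronglyMeasurable
    have hinner : ∀ x, P.optV (r + 1) d - ℓ x - r * e ≤ ∫ ω, F (Function.update ω t x) ∂μ := by
      intro x
      set a := ρ t d x with ha
      have hjoint := hπ.integrable_policyValue_prod (μ := μ) hκ hY r (t + 1) d a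
      have hFx : ∀ ω, F (Function.update ω t x) = P.reward d a
          + ∫ z, P.policyValue (fun t d => ρ t d (ω t)) r (t + 1) (d.extend a z)
            ∂(P.belief d a) := by
        intro ω
        rw [hF]
        simp only [policyValue, Function.update_self]
        congr 2
        funext z
        -- Later decisions read seeds with index above `t` only.
        refine policyValue_congr r (t + 1) _ fun t' ht' d' => ?_
        rw [Function.update_of_ne (by lia)]
      have hGi : Integrable (fun ω : ℕ → X => ∫ z, P.policyValue (fun t d => ρ t d (ω t)) r (t + 1)
          (d.extend a z) ∂(P.belief d a)) μ := hjoint.integral_prod_right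
      simp_rw [hFx]
      rw [integral_add (integrable_const _) hGi, integral_const, probReal_univ, one_smul]
      have hswap : ∫ ω, ∫ z, P.policyValue (fun t d => ρ t d (ω t)) r (t + 1)
            (d.extend a z) ∂(P.belief d a) ∂μ
          = ∫ z, ∫ ω, P.policyValue (fun t d => ρ t d (ω t)) r (t + 1)
            (d.extend a z) ∂μ ∂(P.belief d a) :=
        (integral_integral_swap (f := fun z (ω : ℕ → X) => P.policyValue (fun t d => ρ t d (ω t)) r
          (t + 1) (d.extend a z)) hjoint).symm
      rw [hswap]
      have hmono : ∫ z, P.optV r (d.extend a z) ∂(P.belief d a)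
          ≤ ∫ z, (∫ ω, P.policyValue (fun t d => ρ t d (ω t)) r (t + 1)
            (d.extend a z) ∂μ + r * e) ∂(P.belief d a) := by
        refine integral_mono ((P.lipschitzInOut_optV hκ hY r).integrable_extend P d d a)
          (hjoint.integral_prod_left.add (integrable_const _)) fun z => ?_
        have := ih (t + 1) (d.extend a z) (by lia)
        simp only
        linarith
      rw [integral_add hjoint.integral_prod_left (integrable_const _), integral_const,
        probReal_univ, one_smul] at hmono
      have h1 := hℓ x
      rw [← ha, optQ] at h1
      linarith
    have hfin : ∫ x, (P.optV (r + 1) d - ℓ x - r * e) ∂ν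
        ≤ ∫ x, ∫ ω, F (Function.update ω t x) ∂μ ∂ν :=
      integral_mono (((integrable_const _).sub hℓi).sub (integrable_const _))
        hFi'.integral_prod_right hinner
    have hconst : ∫ x, (P.optV (r + 1) d - ℓ x - r * e) ∂ν
        = P.optV (r + 1) d - ∫ x, ℓ x ∂ν - r * e := by
      have h1 : Integrable (fun x => P.optV (r + 1) d - ℓ x) ν := (integrable_const _).sub hℓi
      rw [integral_sub h1 (integrable_const _), integral_sub (integrable_const _) hℓi]
      simp
    rw [hconst, ← hFint] at hfin
    push_cast
    linarith

end ExpectedLoss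

/-! ### The loss of a single decision of the `ε`-policy. -/

section EpsPolicy

variable {N : ℕ}

theorem measurable_mlV (r n : ℕ) (hn : 0 < n) (s : Fin n → S) :
    Measurable fun y : Fin n → ℝ => P.mlV r ⟨n, hn, s, y⟩ := by
  induction r generalizing n with
  | zero => exact measurable_const
  | succ r ih =>
    have hQ : ∀ a, Measurable fun y : Fin n → ℝ => P.mlQ r ⟨n, hn, s, y⟩ a := by
      intro a
      have h1 : Measurable fun y : Fin n → ℝ => (y, P.postMean ⟨n, hn, s, y⟩ a) :=
        measurable_id.prodMk (P.continuous_postMean hn s a).measurable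
      have h2 := (ih (n + κ) (Nat.add_pos_left hn κ) (Fin.append s a)).comp
        (measurable_append.comp h1)
      exact (P.continuous_reward hn s a).measurable.add h2
    have h := Finset.measurable_sup' (P.actions_nonempty (s ⟨n - 1, by lia⟩))
      (f := fun a (y : Fin n → ℝ) => P.mlQ r ⟨n, hn, s, y⟩ a) fun a _ => hQ a
    convert h using 1
    funext y
    rw [Finset.sup'_apply]
    rfl

theorem measurable_mlQ (r n : ℕ) (hn : 0 < n) (s : Fin n → S) (a : MacroAction S κ) :
    Measurable fun y : Fin n → ℝ => P.mlQ r ⟨n, hn, s, y⟩ a := by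
  have h1 : Measurable fun y : Fin n → ℝ => (y, P.postMean ⟨n, hn, s, y⟩ a) :=
    measurable_id.prodMk (P.continuous_postMean hn s a).measurable
  have h2 := (P.measurable_mlV r (n + κ) (Nat.add_pos_left hn κ) (Fin.append s a)).comp
    (measurable_append.comp h1)
  exact (P.continuous_reward hn s a).measurable.add h2

theorem measurable_epsQ (tol : ℝ) (r n : ℕ) (hn : 0 < n) (s : Fin n → S) (a : MacroAction S κ) :
    Measurable fun p : (Fin n → ℝ) × Seed S κ N => P.epsQ tol r ⟨n, hn, s, p.1⟩ a p.2 := by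
  unfold epsQ
  have h1 := P.measurable_sampQ (N := N) r n hn s a
  have h2 : Measurable fun p : (Fin n → ℝ) × Seed S κ N => P.mlQ r ⟨n, hn, s, p.1⟩ a :=
    (P.measurable_mlQ r n hn s a).comp measurable_fst
  exact Measurable.ite (measurableSet_le (h1.sub h2).abs measurable_const) h1 h2

theorem epsPolicy_mem_epsArgmax (H : ℕ) (lam theta : ℝ)
    {tie : Finset (MacroAction S κ) → MacroAction S κ}
    (htie : ∀ M : Finset (MacroAction S κ), M.Nonempty → tie M ∈ M) (ω : ℕ → Seed S κ N) (t : ℕ)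
    (d : History S) : P.epsPolicy H lam theta tie ω t d
      ∈ P.epsArgmax (lam * H + theta) (H - (t + 1)) d (ω t) :=
  htie _ (filter_max_nonempty (P.actions_nonempty _) _)

theorem isRandomPolicy_epsPolicy (H : ℕ) (lam theta : ℝ)
    {tie : Finset (MacroAction S κ) → MacroAction S κ}
    (htie : ∀ M : Finset (MacroAction S κ), M.Nonempty → tie M ∈ M) :
    P.IsRandomPolicy fun ω : ℕ → Seed S κ N => P.epsPolicy H lam theta tie ω where
  mem_actions ω t d := (Finset.mem_filter.1 (P.epsPolicy_mem_epsArgmax H lam theta htie ω t d)).1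
  measurable t n hn s a := by
    refine measurableSet_tie_filter_max_eq (P.actions (s ⟨n - 1, by lia⟩))
      (q := fun a (p : (Fin n → ℝ) × (ℕ → Seed S κ N)) =>
        P.epsQ (lam * H + theta) (H - (t + 1)) ⟨n, hn, s, p.1⟩ a (p.2 t)) (fun b _ => ?_) tie a
    have h0 : Measurable fun p : (Fin n → ℝ) × (ℕ → Seed S κ N) => (p.1, p.2 t) :=
      measurable_fst.prodMk ((measurable_pi_apply t).comp measurable_snd)
    have h := (P.measurable_epsQ (N := N) (lam * H + theta) (H - (t + 1)) n hn s b).comp h0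
    exact h

variable {P} in
theorem optV_sub_optQ_le_of_forall_abs_sub_le {r : ℕ} {d : History S} {q : MacroAction S κ → ℝ}
    {e : ℝ} (hq : ∀ b ∈ P.actions d.current, |q b - P.optQ r d b| ≤ e) {a : MacroAction S κ}
    (ha : a ∈ P.actions d.current) (hmax : ∀ b ∈ P.actions d.current, q b ≤ q a) :
    P.optV (r + 1) d - P.optQ r d a ≤ 2 * e := by
  have : P.optV (r + 1) d ≤ P.optQ r d a + 2 * e := by
    refine Finset.sup'_le _ _ fun b hb => ?_
    have h1 := (abs_le.1 (hq b hb)).1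
    have h2 := (abs_le.1 (hq a ha)).2
    have h3 := hmax b hb
    change P.optQ r d b ≤ _
    linarith
  linarith

/-- Holds for every seed: a sampled value farther than `b + theta` from `mlQ` is discarded. -/
theorem abs_epsQ_sub_optQ_le {b theta : ℝ} (hb : 0 ≤ b) {r : ℕ} {d : History S}
    {a : MacroAction S κ} (hml : |P.mlQ r d a - P.optQ r d a| ≤ theta) (ω : Seed S κ N) :
    |P.epsQ (b + theta) r d a ω - P.optQ r d a| ≤ b + 2 * theta := by
  have h0 : 0 ≤ theta := (abs_nonneg _).trans hml
  unfold epsQ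
  split_ifs with h
  · have := abs_sub_le (P.sampQ r d a ω) (P.mlQ r d a) (P.optQ r d a)
    linarith
  · linarith

/-- An accurate sampled value always passes the test, so `theta` does not enter the error. -/
theorem abs_epsQ_sub_optQ_le_of_abs_sampQ_sub_optQ_le {b theta : ℝ} {r : ℕ} {d : History S}
    {a : MacroAction S κ} (hml : |P.mlQ r d a - P.optQ r d a| ≤ theta) {ω : Seed S κ N}
    (hs : |P.sampQ r d a ω - P.optQ r d a| ≤ b) :
    |P.epsQ (b + theta) r d a ω - P.optQ r d a| ≤ b := by
  have h : |P.sampQ r d a ω - P.mlQ r d a| ≤ b + theta := by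
    have := abs_sub_le (P.sampQ r d a ω) (P.optQ r d a) (P.mlQ r d a)
    rw [abs_sub_comm (P.optQ r d a)] at this
    linarith
  rw [epsQ, if_pos h]
  exact hs

theorem measurableSet_exists_lt_abs_sampQ_sub_optQ (r : ℕ) (d : History S) (b : ℝ) :
    MeasurableSet {ω : Seed S κ N | ∃ a ∈ P.actions d.current, b < |P.sampQ r d a ω - P.optQ r d a|}
    := by
  have hset : {ω : Seed S κ N | ∃ a ∈ P.actions d.current, b < |P.sampQ r d a ω - P.optQ r d a|}
      = ⋃ a ∈ P.actions d.current, {ω | b < |P.sampQ r d a ω - P.optQ r d a|} := by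
    ext ω; simp
  rw [hset]
  exact Finset.measurableSet_biUnion _ fun a _ => measurableSet_lt measurable_const
    ((P.measurable_sampQ_seed r d a).sub_const _).abs

theorem optV_sub_integral_epsPolicy_le (hκ : 1 ≤ κ) {Y : ℝ} (hY : ∀ s, P.cov s s ≤ Y) (H : ℕ)
    {lam theta delta : ℝ} (hlam : 0 ≤ lam) (htheta : 0 ≤ theta)
    {tie : Finset (MacroAction S κ) → MacroAction S κ}
    (htie : ∀ M : Finset (MacroAction S κ), M.Nonempty → tie M ∈ M)
    (hml : ∀ (r : ℕ) (d : History S), r < H → ∀ a ∈ P.actions d.current,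
      |P.mlQ r d a - P.optQ r d a| ≤ theta)
    (hbad : ∀ (r : ℕ) (d : History S), r < H → (seedMeasure S κ N).real
      {ω | ∃ a ∈ P.actions d.current, lam * H < |P.sampQ r d a ω - P.optQ r d a|} ≤ delta)
    (d₀ : History S) :
    P.optV H d₀ - ∫ ω, P.policyValue (P.epsPolicy H lam theta tie ω) H 0 d₀ ∂(runMeasure S κ N)
      ≤ H * (2 * (lam * H) + 4 * theta * delta) := by
  have hπ := P.isRandomPolicy_epsPolicy (N := N) H lam theta htie
  refine IsRandomPolicy.optV_sub_integral_policyValue_le (ν := seedMeasure S κ N) (H := H)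
    (ρ := fun t d x => tie (P.epsArgmax (lam * H + theta) (H - (t + 1)) d x)) hκ hY hπ ?_ H 0 d₀
    (by lia)
  intro r t d hrt
  have hr : H - (t + 1) = r := by lia
  have hrH : r < H := by lia
  set bad : Set (Seed S κ N) :=
    {ω | ∃ a ∈ P.actions d.current, lam * H < |P.sampQ r d a ω - P.optQ r d a|}
  have hm : MeasurableSet bad := P.measurableSet_exists_lt_abs_sampQ_sub_optQ r d _
  have hind : Integrable (bad.indicator fun _ => 4 * theta) (seedMeasure S κ N) :=
    (integrable_const _).indicator hm
  refine ⟨fun x => 2 * (lam * H) + bad.indicator (fun _ => 4 * theta) x,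
    (integrable_const _).add hind, fun x => ?_, ?_⟩
  · rw [hr]
    beta_reduce
    have hmem : tie (P.epsArgmax (lam * H + theta) r d x) ∈ P.epsArgmax (lam * H + theta) r d x :=
      htie _ (filter_max_nonempty (P.actions_nonempty _) _)
    obtain ⟨h1, h2⟩ := Finset.mem_filter.1 hmem
    by_cases hx : x ∈ bad
    · rw [Set.indicator_of_mem hx]
      refine (optV_sub_optQ_le_of_forall_abs_sub_le (fun b hb => P.abs_epsQ_sub_optQ_le
        (by positivity) (hml r d hrH b hb) x) h1 h2).trans_eq ?_
      ring
    · rw [Set.indicator_of_notMem hx, add_zero]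
      have hx' : ∀ a ∈ P.actions d.current, |P.sampQ r d a x - P.optQ r d a| ≤ lam * H := by
        intro a ha
        by_contra hlt
        exact hx ⟨a, ha, not_le.1 hlt⟩
      exact optV_sub_optQ_le_of_forall_abs_sub_le (fun b hb =>
        P.abs_epsQ_sub_optQ_le_of_abs_sampQ_sub_optQ_le (hml r d hrH b hb) (hx' b hb)) h1 h2
  · rw [integral_add (integrable_const _) hind, integral_const, probReal_univ, one_smul,
      integral_indicator_const _ hm, smul_eq_mul]
    have := mul_le_mul_of_nonneg_right (hbad r d hrH) (by positivity : 0 ≤ 4 * theta)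
    linarith

end EpsPolicy

end MacroGPO

/-! ### The choice of the number of samples. -/

/-- The free parameter `η` makes a logarithm cost an arbitrarily small multiple of `y ^ 2`, which is
needed when `ε` is large. -/
theorem log_le_mul_sq_add {η y : ℝ} (hη : 0 < η) (hy : 0 < y) :
    Real.log y ≤ η * y ^ 2 / 2 + |Real.log η| / 2 := by
  have h1 := Real.log_le_sub_one_of_pos (by positivity : 0 < η * y ^ 2)
  rw [Real.log_mul hη.ne' (by positivity), Real.log_pow] at h1
  have h2 := neg_abs_le (Real.log η)
  push_cast at h1
  linarith

/-- The number of samples suffices for the union bound over the planning tree. -/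
theorem exists_sample_size_const {H : ℕ} (hH : 1 ≤ H) {c k : ℝ} (hc : 0 < c) (hk : 0 < k) :
    ∃ C : ℝ, 0 < C ∧ ∀ (κ A N : ℕ) (ε : ℝ), 1 ≤ κ → 1 ≤ A → 0 < ε →
      C * ((κ : ℝ) ^ (2 * H) / ε ^ 2) * Real.log (2 + κ * A / ε) ≤ N →
      0 < N ∧ (2 * (A : ℝ)) ^ H
        * Real.exp (-(N * (ε / (4 * H)) ^ 2 / (4 * H * (k * (κ : ℝ) ^ (2 * H - 1)))))
        ≤ ε / (8 * (c * (κ : ℝ) ^ ((H : ℝ) + 1 / 2)) * H) := by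
  have hH' : (1 : ℝ) ≤ H := by exact_mod_cast hH
  have hH0 : (0 : ℝ) < H := by linarith
  have hl2 : 0 < Real.log 2 := Real.log_pos (by norm_num)
  -- Chosen so that the exponent of the tail bound is `N * ε ^ 2 / (G * p)` with `p = κ ^ (2 * H -
  -- 1)`.
  set G : ℝ := 64 * (H : ℝ) ^ 3 * k with hG
  have hG0 : 0 < G := by positivity
  set η : ℝ := 1 / (G * H) with hη
  have hη0 : 0 < η := by positivity
  set c1 : ℝ := H * Real.log 2 + |Real.log (8 * c * H)| + H * |Real.log η| with hc1
  have hc10 : 0 ≤ c1 := by positivity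
  clear_value G η c1
  refine ⟨2 * G * ((c1 + H ^ 2 + 2 * H) / Real.log 2 + H), by positivity, ?_⟩
  intro κ A N ε hκ hA hε hN
  have hκ' : (1 : ℝ) ≤ κ := by exact_mod_cast hκ
  have hκ0 : (0 : ℝ) < κ := by linarith
  have hA' : (1 : ℝ) ≤ A := by exact_mod_cast hA
  have hA0 : (0 : ℝ) < A := by linarith
  set l := Real.log (2 + κ * A / ε) with hl
  have hx : 0 < κ * A / ε := by positivity
  have hl2l : Real.log 2 ≤ l := Real.log_le_log (by norm_num) (by linarith)
  have hl0 : 0 < l := hl2.trans_le hl2l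
  have hNpos : (0 : ℝ) < N := lt_of_lt_of_le (by positivity) hN
  have hN1 : (1 : ℝ) ≤ N := by
    have : 0 < N := by exact_mod_cast hNpos
    exact_mod_cast this
  refine ⟨by exact_mod_cast hNpos, ?_⟩
  set T := (N : ℝ) * ε ^ 2 with hT
  have hT1 : ε ^ 2 ≤ T := by
    have := mul_le_mul_of_nonneg_right hN1 (sq_nonneg ε)
    linarith
  have hT2 : 2 * G * ((c1 + H ^ 2 + 2 * H) / Real.log 2 + H) * (κ : ℝ) ^ (2 * H) * l ≤ T := by
    have := mul_le_mul_of_nonneg_right hN (sq_nonneg ε)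
    refine le_trans (le_of_eq ?_) this
    field_simp
  set p : ℝ := (κ : ℝ) ^ (2 * H - 1) with hp
  have hp0 : 0 < p := by positivity
  have hpκ : p * κ = (κ : ℝ) ^ (2 * H) := by
    rw [hp, ← pow_succ]; congr 1; lia
  clear_value l T p
  have hlogκ0 : 0 ≤ Real.log κ := Real.log_nonneg hκ'
  have hlogκ : Real.log κ ≤ κ := (Real.log_le_sub_one_of_pos hκ0).trans (by linarith)
  have hlogA : Real.log κ + Real.log A - Real.log ε ≤ l := by
    rw [hl, ← Real.log_mul hκ0.ne' hA0.ne', ← Real.log_div (by positivity) hε.ne']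
    exact Real.log_le_log hx (by linarith)
  -- For large `ε` the logarithm `l` does not control `log A`, and a term `log ε` remains. It is
  -- split into `log y` and a multiple of `log κ`; the former is absorbed using `ε ^ 2 ≤ T`, which
  -- holds because `N` is at least 1.
  set y := ε / (κ : ℝ) ^ H with hy
  have hy0 : 0 < y := by positivity
  have hlogy : Real.log ε = Real.log y + H * Real.log κ := by
    rw [hy, Real.log_div hε.ne' (by positivity), Real.log_pow]; ring
  clear_value y
  have hlogy' := log_le_mul_sq_add hη0 hy0
  have hB : H * Real.log (2 * A) - Real.log ε + Real.log (8 * c * H) + (H + 1 / 2) * Real.log κ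
      ≤ c1 + H * l + H * (η * y ^ 2 / 2) + (H ^ 2 + 2 * H) * κ := by
    rw [Real.log_mul (by norm_num) hA0.ne']
    -- One `log A` is paired with `-log ε` and bounded by `l`; the other `H - 1` copies leave the
    -- excess `log ε`.
    have h1 : (H - 1 : ℝ) * Real.log A ≤ (H - 1) * (l + (η * y ^ 2 / 2 + |Real.log η| / 2) + H * κ) := by
      refine mul_le_mul_of_nonneg_left ?_ (by linarith)
      have : (H : ℝ) * Real.log κ ≤ H * κ := mul_le_mul_of_nonneg_left hlogκ hH0.le
      linarith
    have h2 : (H - 1 : ℝ) * (η * y ^ 2 / 2 + |Real.log η| / 2 + H * κ)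
        ≤ H * (η * y ^ 2 / 2 + |Real.log η| / 2 + H * κ) := by
      refine mul_le_mul_of_nonneg_right (by linarith) (by positivity)
    have h3 : Real.log A - Real.log ε ≤ l := by linarith
    have h4 : ((H : ℝ) + 1 / 2) * Real.log κ ≤ (2 * H) * κ :=
      mul_le_mul (by linarith) hlogκ hlogκ0 (by positivity)
    have h5 := le_abs_self (Real.log (8 * c * H))
    have h6 : 0 ≤ H * |Real.log η| := by positivity
    have h7 : (H - 1 : ℝ) * (l + (η * y ^ 2 / 2 + |Real.log η| / 2) + H * κ)
        = H * l - l + (H - 1 : ℝ) * (η * y ^ 2 / 2 + |Real.log η| / 2 + H * κ) := by ring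
    rw [hc1]
    linarith
  have hmain : G * p * (H * Real.log (2 * A) - Real.log ε + Real.log (8 * c * H)
      + (H + 1 / 2) * Real.log κ) ≤ T := by
    have hGp : 0 ≤ G * p := by positivity
    refine (mul_le_mul_of_nonneg_left hB hGp).trans ?_
    have e1 : G * p * (H * (η * y ^ 2 / 2)) ≤ T / 2 := by
      have : G * p * (H * (η * y ^ 2 / 2)) = p * y ^ 2 / 2 := by
        rw [hη]; field_simp
      rw [this]
      have h8 : p * y ^ 2 ≤ ε ^ 2 := by
        rw [hy, div_pow, ← pow_mul, mul_comm H 2, ← hpκ]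
        rw [mul_div_assoc', div_le_iff₀ (by positivity)]
        have : p * ε ^ 2 * 1 ≤ p * ε ^ 2 * κ := by gcongr
        linarith
      linarith
    have e2 : G * p * (c1 + H * l + (H ^ 2 + 2 * H) * κ) ≤ T / 2 := by
      -- The spare factor `κ` between `p` and `κ ^ (2 * H)` absorbs the terms in `log κ`, and `log 2
      -- ≤ l` turns constants into multiples of `l`.
      have h9 : c1 + H * l + (H ^ 2 + 2 * H) * κ
          ≤ ((c1 + H ^ 2 + 2 * H) / Real.log 2 + H) * l * κ := by
        have h10 : c1 + H ^ 2 + 2 * H ≤ (c1 + H ^ 2 + 2 * H) / Real.log 2 * l := by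
          rw [div_mul_eq_mul_div, le_div_iff₀ hl2]
          exact mul_le_mul_of_nonneg_left hl2l (by positivity)
        have h11 := mul_le_mul_of_nonneg_right h10 hκ0.le
        have h12 : c1 * 1 ≤ c1 * κ := by gcongr
        have h13 : H * l * 1 ≤ H * l * κ := by gcongr
        linarith
      have h14 := mul_le_mul_of_nonneg_left h9 hGp
      have h15 : G * p * (((c1 + H ^ 2 + 2 * H) / Real.log 2 + H) * l * κ)
          = (2 * G * ((c1 + H ^ 2 + 2 * H) / Real.log 2 + H) * (κ : ℝ) ^ (2 * H) * l) / 2 := by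
        rw [← hpκ]; ring
      linarith
    have e3 : G * p * (c1 + H * l + H * (η * y ^ 2 / 2) + (H ^ 2 + 2 * H) * κ)
        = G * p * (c1 + H * l + (H ^ 2 + 2 * H) * κ) + G * p * (H * (η * y ^ 2 / 2)) := by ring
    linarith
  have hexp : N * (ε / (4 * H)) ^ 2 / (4 * H * (k * p)) = T / (G * p) := by
    rw [hT, hG]; field_simp; ring
  rw [hexp]
  have hlhs : 0 < (2 * (A : ℝ)) ^ H * Real.exp (-(T / (G * p))) := by positivity
  have hrpow : 0 < (κ : ℝ) ^ ((H : ℝ) + 1 / 2) := Real.rpow_pos_of_pos hκ0 _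
  rw [← Real.log_le_log_iff hlhs (by positivity), Real.log_mul (by positivity) (Real.exp_pos _).ne',
    Real.log_exp, Real.log_pow, Real.log_div hε.ne' (by positivity)]
  have hden : Real.log (8 * (c * (κ : ℝ) ^ ((H : ℝ) + 1 / 2)) * H)
      = Real.log (8 * c * H) + (H + 1 / 2) * Real.log κ := by
    rw [← Real.log_rpow hκ0, ← Real.log_mul (by positivity) hrpow.ne']
    congr 1; ring
  rw [hden]
  have := (le_div_iff₀' (by positivity : 0 < G * p)).2 hmain
  linarith

/-! ### Tail bound with explicit constants, and the theorem. -/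

namespace MacroGPO

variable {S : Type u} {κ N : ℕ} (P : MacroGPO S κ)

theorem seedMeasure_real_exists_lt_abs_le (hκ : 1 ≤ κ) (hN : 0 < N) {Y : ℝ} (hY0 : 0 ≤ Y)
    (hY : ∀ s, P.cov s s ≤ Y) {A : ℕ} (hA1 : 1 ≤ A) (hA : ∀ s, (P.actions s).card ≤ A) {r H : ℕ}
    (hr : r < H) {k b : ℝ} (hk0 : 0 < k) (hb : 0 ≤ b)
    (hk : lipCoeff √(Y / P.noiseVar) H ^ 2 * (Y + P.noiseVar) ≤ k) (d : History S) :
    (seedMeasure S κ N).real {ω | ∃ a ∈ P.actions d.current, b < |P.sampQ r d a ω - P.optQ r d a|}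
      ≤ (2 * (A : ℝ)) ^ H
        * Real.exp (-(N * b ^ 2 / (4 * H * (k * (κ : ℝ) ^ (2 * H - 1))))) := by
  have hκ' : (1 : ℝ) ≤ κ := by exact_mod_cast hκ
  have hA' : (1 : ℝ) ≤ A := by exact_mod_cast hA1
  have hN' : (0 : ℝ) < N := by exact_mod_cast hN
  have hH' : (0 : ℝ) < H := by exact_mod_cast (by lia : 0 < H)
  set K := k * (κ : ℝ) ^ (2 * H - 1) with hK
  have hK0 : 0 < K := by positivity
  have hL : 0 ≤ √(Y / P.noiseVar) := Real.sqrt_nonneg _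
  have hv : 0 ≤ Y + P.noiseVar := add_nonneg hY0 P.noiseVar_pos.le
  have hKb : ∀ j ≤ r, (lipCoeff √(Y / P.noiseVar) j * κ ^ j) ^ 2 * κ * (Y + P.noiseVar) ≤ K := by
    intro j hj
    have h1 := lipCoeff_mono hL (by lia : j ≤ H)
    have h2 := lipCoeff_nonneg hL j
    have h3 : (κ : ℝ) ^ (2 * j + 1) ≤ κ ^ (2 * H - 1) := pow_le_pow_right₀ hκ' (by lia)
    calc _ = lipCoeff √(Y / P.noiseVar) j ^ 2 * (Y + P.noiseVar) * κ ^ (2 * j + 1) := by ring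
      _ ≤ lipCoeff √(Y / P.noiseVar) H ^ 2 * (Y + P.noiseVar) * κ ^ (2 * H - 1) := by gcongr
      _ ≤ K := by rw [hK]; gcongr
  -- The minimizer of `H * s ^ 2 * K / N - s * b`, with minimum `-(N * b ^ 2 / (4 * H * K))`.
  set s : ℝ := N * b / (2 * H * K) with hs
  have hs0 : 0 ≤ s := by positivity
  have h := P.seedMeasure_exists_lt_abs_le hκ hN hY hA r hKb hs0 d b
  have e1 : (A : ENNReal) * (2 * ENNReal.ofReal (Real.exp (s ^ 2 * K / N)))
      = ENNReal.ofReal (2 * A * Real.exp (s ^ 2 * K / N)) := by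
    rw [ENNReal.ofReal_mul (by positivity), ENNReal.ofReal_mul (by norm_num),
      ENNReal.ofReal_natCast]
    simp only [ENNReal.ofReal_ofNat]
    ring
  rw [e1, ← ENNReal.ofReal_pow (by positivity), ← ENNReal.ofReal_mul (by positivity)] at h
  refine (ENNReal.toReal_le_of_le_ofReal (by positivity) h).trans ?_
  -- A base of at least 1 allows the exponent `r + 1` to be raised to `H`.
  have hone : 1 ≤ 2 * A * Real.exp (s ^ 2 * K / N) := by
    have : 1 ≤ Real.exp (s ^ 2 * K / N) := Real.one_le_exp (by positivity)
    nlinarith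
  calc _ ≤ (2 * A * Real.exp (s ^ 2 * K / N)) ^ H * Real.exp (-(s * b)) := by
        gcongr
        lia
    _ = _ := by
      rw [mul_pow, ← Real.exp_nat_mul, mul_assoc, ← Real.exp_add]
      congr 2
      rw [hs]
      field_simp
      ring

end MacroGPO

theorem theorem3 (H : ℕ) (hH : 1 ≤ H) (sigY2 sigN2 : ℝ) (hY : 0 ≤ sigY2) (hN : 0 < sigN2) :
    ∃ c₀ : ℝ, 0 < c₀ ∧ ∀ c : ℝ, c₀ ≤ c → ∃ C : ℝ, 0 < C ∧
      ∀ (S : Type u) (κ : ℕ) (P : MacroGPO S κ) (A : ℕ), 1 ≤ κ →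
        (∀ s, P.cov s s ≤ sigY2) → P.noiseVar = sigN2 →
        (∀ s, (P.actions s).card ≤ A) →
        ∀ theta : ℝ, theta = c * (κ : ℝ) ^ ((H : ℝ) + 1 / 2) →
          -- `theta` bounds the error of the most likely observations
          (∀ (t : ℕ) (d : History S), t < H → ∀ a ∈ P.actions d.current,
            |P.mlQ (H - (t + 1)) d a - P.optQ (H - (t + 1)) d a| ≤ theta) ∧
          -- `optV` is the maximal value of a policy
          (∀ d₀ : History S,
            IsGreatest {v | ∃ π, P.IsPolicy π ∧ v = P.policyValue π H 0 d₀} (P.optV H d₀)) ∧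
          ∀ eps lam delta : ℝ, 0 < eps →
            lam = eps / (4 * (H : ℝ) ^ 2) → delta = eps / (8 * theta * H) →
            ∀ N : ℕ,
              C * ((κ : ℝ) ^ (2 * H) / eps ^ 2) * Real.log (2 + κ * A / eps) ≤ N →
              -- the sampled values are accurate with probability at least `1 - delta`
              (∀ (t : ℕ) (d : History S), t < H →
                1 - delta ≤ (MacroGPO.seedMeasure S κ N).real
                  {ω | ∀ a ∈ P.actions d.current,
                    |P.sampQ (H - (t + 1)) d a ω - P.optQ (H - (t + 1)) d a| ≤ lam * H}) ∧
              -- the expected loss of the policy is at most `eps`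
              ∀ (tie : Finset (MacroAction S κ) → MacroAction S κ),
                (∀ M : Finset (MacroAction S κ), M.Nonempty → tie M ∈ M) →
                (∀ ω : ℕ → MacroGPO.Seed S κ N, P.IsPolicy (P.epsPolicy H lam theta tie ω)) ∧
                ∀ d₀ : History S,
                  Integrable
                    (fun ω => P.policyValue (P.epsPolicy H lam theta tie ω) H 0 d₀)
                    (MacroGPO.runMeasure S κ N) ∧
                  P.optV H d₀
                    - ∫ ω, P.policyValue (P.epsPolicy H lam theta tie ω) H 0 d₀
                        ∂(MacroGPO.runMeasure S κ N) ≤ eps := by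
  have hH0 : (0 : ℝ) < H := by exact_mod_cast hH
  set L := √(sigY2 / sigN2) with hL
  have hL0 : 0 ≤ L := Real.sqrt_nonneg _
  set v := sigY2 + sigN2 with hv
  have hv0 : 0 < v := by positivity
  have hlip := lipCoeff_nonneg hL0 H
  -- This is the constant of `mlBound_le`; the added 1 keeps it positive when `sigY2 = 0`.
  refine ⟨H * (lipCoeff L H * (1 + v)) + 1, by positivity, fun c hc => ?_⟩
  have hc0 : 0 < c := lt_of_lt_of_le (by positivity) hc
  obtain ⟨C, hC0, hC⟩ := exists_sample_size_const hH hc0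
    (by positivity : 0 < lipCoeff L H ^ 2 * v + 1)
  refine ⟨C, hC0, ?_⟩
  rintro S κ P A hκ hPY rfl hA theta htheta
  have hκ' : (1 : ℝ) ≤ κ := by exact_mod_cast hκ
  have hκ0 : (0 : ℝ) < κ := by linarith
  have htheta0 : 0 < theta := by
    rw [htheta]
    exact mul_pos hc0 (Real.rpow_pos_of_pos hκ0 _)
  have hml : ∀ (r : ℕ) (d : History S), r < H → ∀ a ∈ P.actions d.current,
      |P.mlQ r d a - P.optQ r d a| ≤ theta := by
    intro r d hr a _
    refine (P.abs_mlQ_sub_optQ_le hκ hPY r d a).trans ((MacroGPO.mlBound_le hL0 hv0.le hκ hr).trans ?_)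
    have h1 : (κ : ℝ) ^ H ≤ (κ : ℝ) ^ ((H : ℝ) + 1 / 2) := by
      rw [← Real.rpow_natCast]
      exact Real.rpow_le_rpow_of_exponent_le hκ' (by linarith)
    rw [htheta]
    exact mul_le_mul (by linarith) h1 (by positivity) hc0.le
  refine ⟨fun t d ht => hml _ d (by lia), fun d₀ => P.isGreatest_optV hκ hPY H d₀, ?_⟩
  intro eps lam delta heps hlam hdelta N hN
  have hlamH : lam * H = eps / (4 * H) := by rw [hlam]; field_simp
  have hlam0 : 0 ≤ lam := by rw [hlam]; positivity
  have hbad : ∀ (r : ℕ) (d : History S), r < H → (MacroGPO.seedMeasure S κ N).real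
      {ω | ∃ a ∈ P.actions d.current, lam * H < |P.sampQ r d a ω - P.optQ r d a|} ≤ delta := by
    intro r d hr
    have hA1 : 1 ≤ A := (P.actions_nonempty d.current).card_pos.trans_le (hA _)
    obtain ⟨hN0, hle⟩ := hC κ A N eps hκ hA1 heps hN
    rw [hdelta, htheta]
    refine le_trans ?_ hle
    rw [hlamH]
    exact P.seedMeasure_real_exists_lt_abs_le hκ hN0 hY hPY hA1 hA hr (by positivity)
      (by positivity) (by linarith) d
  refine ⟨fun t d ht => ?_, fun tie htie => ⟨fun ω =>
    (P.isRandomPolicy_epsPolicy H lam theta htie).isPolicy ω, fun d₀ => ⟨?_, ?_⟩⟩⟩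
  · have h1 := hbad (H - (t + 1)) d (by lia)
    have hm := P.measurableSet_exists_lt_abs_sampQ_sub_optQ (N := N) (H - (t + 1)) d (lam * H)
    have h2 := probReal_compl_eq_one_sub (μ := MacroGPO.seedMeasure S κ N) hm
    have e : {ω : MacroGPO.Seed S κ N | ∀ a ∈ P.actions d.current,
        |P.sampQ (H - (t + 1)) d a ω - P.optQ (H - (t + 1)) d a| ≤ lam * H}
        = {ω | ∃ a ∈ P.actions d.current,
          lam * H < |P.sampQ (H - (t + 1)) d a ω - P.optQ (H - (t + 1)) d a|}ᶜ := by
      ext ω; simp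
    rw [e, h2]
    linarith
  · exact (P.isRandomPolicy_epsPolicy H lam theta htie).integrable_policyValue hκ hPY H 0 d₀
  · refine (P.optV_sub_integral_epsPolicy_le hκ hPY H hlam0 htheta0.le htie hml hbad d₀).trans_eq ?_
    -- Per stage, `2 * lam * H` and `4 * theta * delta` both equal `eps / (2 * H)`.
    rw [hlamH, hdelta]
    field_simp
    ring

end
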